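/- **Setting.** Let $U\subset\mathbb R^4$ be open with coordinates $\bar x=(x^0,x^\alpha)=(\tau,x^1,x^2,x^3)$, let $\eta=\mathrm{diag}(-1,1,1,1)$ and $S_{ac}{}^{bd}=\delta_a{}^b\delta_c{}^d+\delta_a{}^d\delta_c{}^b-\eta_{ac}\eta^{bd}$. Indices $a,b,\dots$ run over $0,\dots,3$ and $i,j,\dots$ over $1,2,3$. The unknowns are $C^1$ fields on $U$: a frame $e_a=e_a{}^\mu\partial_\mu$ (declared orthonormal for a metric $g$); connection coefficients $\hat\Gamma_a{}^b{}_c$ ($\hat\nabla_ae_c=\hat\Gamma_a{}^b{}_ce_b$) with $\hat\nabla_a\eta_{bc}=-2f_a\eta_{bc}$, $f_a=\frac14\hat\Gamma_a{}^b{}_b$; a tensor $\hat L_{ab}$; and a tensor $d^a{}_{bcd}$ with the algebraic symmetries of the Weyl tensor. Let $\Xi$ and $d_a$ be prescribed smooth functions on $U$ (the conformal gauge fields). The extended conformal Einstein field equations are $$[e_a,e_b]=(\hat\Gamma_a{}^c{}_b-\hat\Gamma_b{}^c{}_a)e_c,\qquad R^c{}_{dab}=\Xi\, d^c{}_{dab}+2S_{d[a}{}^{ce}\hat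 L_{b]e},$$ $$\hat\nabla_c\hat L_{db}-\hat\nabla_d\hat L_{cb}=d_a d^a{}_{bcd},\qquad \hat\nabla_ad^a{}_{bcd}=f_ad^a{}_{bcd},$$ where $$R^c{}_{dab}=e_a(\hat\Gamma_b{}^c{}_d)-e_b(\hat\Gamma_a{}^c{}_d)+\hat\Gamma_f{}^c{}_d(\hat\Gamma_b{}^f{}_a-\hat\Gamma_a{}^f{}_b)+\hat\Gamma_b{}^f{}_d\hat\Gamma_a{}^c{}_f-\hat\Gamma_a{}^f{}_d\hat\Gamma_b{}^c{}_f .$$ The conformal Gaussian gauge is: $e_0=\partial_\tau$, $\hat\Gamma_0{}^a{}_b=0$, $\hat L_{0a}=0$ (hence $f_0=0$). Let $\Gamma_a{}^b{}_c=\hat\Gamma_a{}^b{}_c-S_{ac}{}^{bd}f_d$ be the Levi-Civita coefficients, $\chi_{ij}=\Gamma_i{}^j{}_0$, $\chi=\chi_k{}^k$, $a_i=\Gamma_0{}^i{}_0$, let $D$ be the spatial derivative $D_kT_{ij}=e_k(T_{ij})-\Gamma_k{}^l{}_iT_{lj}-\Gamma_k{}^l{}_jT_{il}$, and let $d_{ij}=d_{i0j0}$,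 $d^*_{ij}=d^*_{i0j0}$ with $d^*_{abcd}=\frac12\epsilon_{ab}{}^{ef}d_{efcd}$, $\epsilon_{0123}=-1$, and $\epsilon_{ijk}$ totally antisymmetric with $\epsilon_{123}=1$. **Lemma.** In a conformal Gaussian gauge every solution of the extended conformal Einstein field equations satisfies the evolution equations $$\partial_\tau e_b{}^\nu=-\hat\Gamma_b{}^c{}_0e_c{}^\nu,\qquad \partial_\tau\hat L_{db}=-\hat\Gamma_d{}^c{}_0\hat L_{cb}+d_ad^a{}_{b0d},\qquad \partial_\tau f_i=-f_j\hat\Gamma_i{}^j{}_0+\hat L_{i0},$$ $$\partial_\tau\hat\Gamma_b{}^c{}_d=-\hat\Gamma_f{}^c{}_d\hat\Gamma_b{}^f{}_0+\Xi\,d^c{}_{d0b}+\delta_d{}^c\hat L_{b0}+\delta_0{}^c\hat L_{bd}-\eta_{d0}\eta^{ce}\hat L_{be},$$ $$\partial_\tau d_{ij}+\epsilon^{kl}{}_{(j}D_{|l|}d^*_{i)k}=-2a_l\epsilon^{kl}{}_{(j}d^*_{i)k}+X_{ij}(d),\qquad \partial_\tau d^*_{ij}-\epsilon^{kl}{}_{(j}D_{|l|}d_{i)k}=2a_l\epsilon^{kl}{}_{(j}d_{i)k}+X_{ij}(d^*),$$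 with $X_{ij}(T)=-2\chi T_{ij}+2\chi^k{}_{(i}T_{j)k}+\chi_{(i}{}^kT_{j)k}-\delta_{ij}\chi^{kl}T_{kl}$. Moreover, let $\boldsymbol\upsilon=(\boldsymbol e,\boldsymbol\Gamma,\boldsymbol L)$ consist of the independent components $\boldsymbol e=(e_i{}^\mu)$, $\boldsymbol\Gamma=(\hat\Gamma_i{}^j{}_0,\ \hat\Gamma_i{}^2{}_3,\hat\Gamma_i{}^3{}_1,\hat\Gamma_i{}^1{}_2,\ f_i)$, $\boldsymbol L=(\hat L_{ia})$, and let $\boldsymbol\phi=(\boldsymbol d,\boldsymbol d^*)\in\mathbb R^{5}\oplus\mathbb R^5$ consist of the components of $d_{ij}$, $d^*_{ij}$ in an orthonormal basis of the symmetric trace-free $3\times3$ matrices. Then there are a constant matrix $\mathbf K$, smooth matrix-valued functions $\mathbf Q(\boldsymbol\Gamma)$, $\mathbf B(\boldsymbol\Gamma)$ and Hermitian matrices $\mathbf A^\mu(\boldsymbol e)$ depending smoothly on $\boldsymbol e$, all independent of $U$, of $(\Xi,d_a)$ and of the fields, with $\mathbf I+\mathbf A^0(\boldsymbol e)$ positive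 definite whenever $\sum_i(e_i{}^0)^2<1$ (that is, whenever $d\tau$ is timelike), and, for each choice of $U$ and $(\Xi,d_a)$, a smooth matrix-valued function $\mathbf L(\bar x)$ on $U$, such that for all fields as above in a conformal Gaussian gauge the evolution equations are equivalent to the symmetric hyperbolic system $$\partial_\tau\boldsymbol\upsilon=\mathbf K\boldsymbol\upsilon+\mathbf Q(\boldsymbol\Gamma)\boldsymbol\upsilon+\mathbf L(\bar x)\boldsymbol\phi,\qquad (\mathbf I+\mathbf A^0(\boldsymbol e))\partial_\tau\boldsymbol\phi+\mathbf A^\alpha(\boldsymbol e)\partial_\alpha\boldsymbol\phi=\mathbf B(\boldsymbol\Gamma)\boldsymbol\phi .$$ -/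

import Mathlib

open scoped ContDiff Matrix

noncomputable section

namespace XCFE

/-- Coordinates `(τ, x¹, x², x³)`; index `0` is the time coordinate `τ`. -/
abbrev Coord : Type := Fin 4 → ℝ

/-- Coordinate partial derivative `∂_μ f`. -/
def pd (μ : Fin 4) (f : Coord → ℝ) (x : Coord) : ℝ := fderiv ℝ f x (Pi.single μ 1)

/-- Kronecker delta. -/
def kd {n : ℕ} (a b : Fin n) : ℝ := if a = b then 1 else 0

/-- The Minkowski matrix `η = diag(-1, 1, 1, 1)`; it equals its own inverse. -/
def eta (a b : Fin 4) : ℝ := if a = b then (if a = 0 then -1 else 1) else 0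

/-- The totally antisymmetric symbol with value `1` at `(0, 1, …, n - 1)`. -/
def perm {n : ℕ} (v : Fin n → Fin n) : ℝ := Matrix.det (Matrix.of fun i j => kd (v i) j)

/-- Spatial volume form, `ε_{123} = 1` (spatial indices are `Fin 3`, index `i` being the
frame index `i.succ`). -/
def eps3 (i j k : Fin 3) : ℝ := perm ![i, j, k]

/-- Spacetime volume form of an orthonormal frame, `ε_{0123} = -1`, `ε^{0123} = 1`. -/
def eps4 (a b c d : Fin 4) : ℝ := - perm ![a, b, c, d]

/-- `S_{ac}{}^{bd} = δ_a{}^b δ_c{}^d + δ_a{}^d δ_c{}^b - η_{ac} η^{bd}`, arguments in the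
order `a c b d`. -/
def tensorS (a c b d : Fin 4) : ℝ := kd a b * kd c d + kd a d * kd c b - eta a c * eta b d

/-- The unknowns, as components with respect to the frame. -/
structure Fields where
  /-- `e a μ` is the frame coefficient `e_a{}^μ`, so that `e_a = e_a{}^μ ∂_μ`. -/
  e : Fin 4 → Fin 4 → Coord → ℝ
  /-- `Γ a b c` is the Weyl connection coefficient `Γ̂_a{}^b{}_c`, i.e.
  `∇̂_a e_c = Γ̂_a{}^b{}_c e_b`. -/
  Γ : Fin 4 → Fin 4 → Fin 4 → Coord → ℝ
  /-- `L a b` is the component `L̂_{ab}` of the Schouten tensor of the Weyl connection. -/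
  L : Fin 4 → Fin 4 → Coord → ℝ
  /-- `d a b c f` is the component `d^a{}_{bcf}` of the rescaled Weyl tensor. -/
  d : Fin 4 → Fin 4 → Fin 4 → Fin 4 → Coord → ℝ

namespace Fields

variable (u : Fields)

/-- Directional derivative along the frame vector `e_a`. -/
def dir (a : Fin 4) (g : Coord → ℝ) (x : Coord) : ℝ := ∑ μ, u.e a μ x * pd μ g x

/-- The covector `f_a = ¼ Γ̂_a{}^b{}_b` defining the Weyl connection. -/
def f (a : Fin 4) (x : Coord) : ℝ := (1 / 4) * ∑ b, u.Γ a b b x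

/-- The rescaled Weyl tensor with lowered first index, `d_{abcf} = η_{ag} d^g{}_{bcf}`. -/
def dlow (a b c f : Fin 4) (x : Coord) : ℝ := ∑ g, eta a g * u.d g b c f x

/-- The fields on `U` are of the algebraic type required: a `C¹` frame, declared orthonormal,
with `C¹` coefficients of a connection satisfying `∇̂_a g_{bc} = -2 f_a g_{bc}` (torsion-freeness
is one of the field equations), a `C¹` covariant 2-tensor, and a `C¹` tensor with the
symmetries of the Weyl tensor. -/
structure IsConfiguration (U : Set Coord) : Prop where
  smooth_e : ∀ a μ, ContDiffOn ℝ 1 (u.e a μ) U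
  smooth_Γ : ∀ a b c, ContDiffOn ℝ 1 (u.Γ a b c) U
  smooth_L : ∀ a b, ContDiffOn ℝ 1 (u.L a b) U
  smooth_d : ∀ a b c g, ContDiffOn ℝ 1 (u.d a b c g) U
  frame : ∀ x ∈ U, (Matrix.of fun a μ => u.e a μ x).det ≠ 0
  weyl_connection : ∀ x ∈ U, ∀ a b c,
    -(∑ g, u.Γ a g b x * eta g c) - ∑ g, u.Γ a g c x * eta b g = -2 * u.f a x * eta b c
  antisymm_left : ∀ x ∈ U, ∀ a b c g, u.dlow a b c g x = - u.dlow b a c g x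
  antisymm_right : ∀ x ∈ U, ∀ a b c g, u.dlow a b c g x = - u.dlow a b g c x
  pair_symm : ∀ x ∈ U, ∀ a b c g, u.dlow a b c g x = u.dlow c g a b x
  cyclic : ∀ x ∈ U, ∀ a b c g, u.dlow a b c g x + u.dlow a c g b x + u.dlow a g b c x = 0
  trace_free : ∀ x ∈ U, ∀ b g, ∑ a, u.d a b a g x = 0

/-! ### The extended conformal Einstein field equations -/

/-- The `∂_ν`-component of `Σ_a{}^c{}_b e_c = [e_a, e_b] - (Γ̂_a{}^c{}_b - Γ̂_b{}^c{}_a) e_c`. -/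
def zeroTorsion (a b ν : Fin 4) (x : Coord) : ℝ :=
  (u.dir a (u.e b ν) x - u.dir b (u.e a ν) x)
    - ∑ c, (u.Γ a c b x - u.Γ b c a x) * u.e c ν x

/-- The geometric curvature `R^c{}_{dab}`, arguments in the order `c d a b`. -/
def geomCurv (c d a b : Fin 4) (x : Coord) : ℝ :=
  u.dir a (u.Γ b c d) x - u.dir b (u.Γ a c d) x
    + ∑ g, u.Γ g c d x * (u.Γ b g a x - u.Γ a g b x)
    + ∑ g, (u.Γ b g d x * u.Γ a c g x - u.Γ a g d x * u.Γ b c g x)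

/-- The algebraic curvature `ρ^c{}_{dab} = Ξ d^c{}_{dab} + 2 S_{d[a}{}^{ce} L̂_{b]e}`. -/
def algCurv (Ξ : Coord → ℝ) (c d a b : Fin 4) (x : Coord) : ℝ :=
  Ξ x * u.d c d a b x
    + ∑ g, (tensorS d a c g * u.L b g x - tensorS d b c g * u.L a g x)

/-- The covariant derivative `∇̂_c L̂_{db}`. -/
def covL (c d b : Fin 4) (x : Coord) : ℝ :=
  u.dir c (u.L d b) x - ∑ g, u.Γ c g d x * u.L g b x - ∑ g, u.Γ c g b x * u.L d g x

/-- `Δ_{cdb} = ∇̂_c L̂_{db} - ∇̂_d L̂_{cb} - d_a d^a{}_{bcd}`, `κ` being the gauge covector `d_a`. -/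
def zeroDelta (κ : Fin 4 → Coord → ℝ) (c d b : Fin 4) (x : Coord) : ℝ :=
  u.covL c d b x - u.covL d c b x - ∑ a, κ a x * u.d a b c d x

/-- The covariant derivative `∇̂_h d^a{}_{bcg}`. -/
def covd (h a b c g : Fin 4) (x : Coord) : ℝ :=
  u.dir h (u.d a b c g) x + ∑ k, u.Γ h a k x * u.d k b c g x
    - ∑ k, u.Γ h k b x * u.d a k c g x - ∑ k, u.Γ h k c x * u.d a b k g x
    - ∑ k, u.Γ h k g x * u.d a b c k x

/-- `Λ_{bcg} = ∇̂_a d^a{}_{bcg} - f_a d^a{}_{bcg}`. -/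
def zeroLambda (b c g : Fin 4) (x : Coord) : ℝ :=
  ∑ a, u.covd a a b c g x - ∑ a, u.f a x * u.d a b c g x

/-- The extended conformal Einstein field equations on `U`, for the conformal gauge fields
`Ξ` and `κ = (d_a)`. -/
structure ExtendedCFE (Ξ : Coord → ℝ) (κ : Fin 4 → Coord → ℝ) (U : Set Coord) : Prop where
  torsion : ∀ x ∈ U, ∀ a b ν, u.zeroTorsion a b ν x = 0
  curvature : ∀ x ∈ U, ∀ c d a b, u.geomCurv c d a b x - u.algCurv Ξ c d a b x = 0
  schouten : ∀ x ∈ U, ∀ c d b, u.zeroDelta κ c d b x = 0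
  bianchi : ∀ x ∈ U, ∀ b c g, u.zeroLambda b c g x = 0

/-- The conformal Gaussian gauge on `U`: `e_0 = ∂_τ`, the frame is Weyl propagated
(`∇̂_{e_0} e_a = 0`), and `L̂(e_0, ·) = 0`. The case `a = 0` of the second condition together with
the third says that the integral curves of `∂_τ` are conformal geodesics.
The condition `f_0 = 0` is a consequence, see `f_zero_of_gauge`. -/
structure ConformalGaussianGauge (U : Set Coord) : Prop where
  time_leg : ∀ x ∈ U, ∀ μ, u.e 0 μ x = kd 0 μ
  weyl_propagated : ∀ x ∈ U, ∀ a b, u.Γ 0 b a x = 0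
  schouten_zero : ∀ x ∈ U, ∀ a, u.L 0 a x = 0

theorem f_zero_of_gauge {u : Fields} {U : Set Coord} (h : u.ConformalGaussianGauge U)
    {x : Coord} (hx : x ∈ U) : u.f 0 x = 0 := by
  simp [f, h.weyl_propagated x hx]

/-! ### The evolution equations -/

/-- The connection coefficients `Γ_a{}^b{}_c = Γ̂_a{}^b{}_c - S_{ac}{}^{bg} f_g` of the
Levi-Civita connection of `g`. -/
def lc (a b c : Fin 4) (x : Coord) : ℝ := u.Γ a b c x - ∑ g, tensorS a c b g * u.f g x

/-- `χ_{ij} = Γ_i{}^j{}_0`, i.e. `∇_{e_i} e_0 = χ_{ij} e_j`. -/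
def chi (i j : Fin 3) (x : Coord) : ℝ := u.lc i.succ j.succ 0 x

/-- The trace `χ = χ_k{}^k`. -/
def trchi (x : Coord) : ℝ := ∑ k, u.chi k k x

/-- The acceleration `a_i = Γ_0{}^i{}_0` of `e_0`. -/
def acc (i : Fin 3) (x : Coord) : ℝ := u.lc 0 i.succ 0 x

/-- Left Hodge dual of the rescaled Weyl tensor,
`d*_{abcg} = ½ ε_{ab}{}^{hk} d_{hkcg}`. -/
def dstar (a b c g : Fin 4) (x : Coord) : ℝ :=
  (1 / 2) * ∑ h, ∑ k, ∑ m, ∑ n, eps4 a b m n * eta m h * eta n k * u.dlow h k c g x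

/-- Electric part `d_{ij} = d_{i0j0}` with respect to `e_0`. -/
def el (i j : Fin 3) (x : Coord) : ℝ := u.dlow i.succ 0 j.succ 0 x

/-- Magnetic part `d*_{ij} = d*_{i0j0}` with respect to `e_0`. -/
def mag (i j : Fin 3) (x : Coord) : ℝ := u.dstar i.succ 0 j.succ 0 x

/-- Spatial covariant derivative `D_k T_{ij}`, formed with the spatial part of the Levi-Civita
connection coefficients. -/
def covD (T : Fin 3 → Fin 3 → Coord → ℝ) (k i j : Fin 3) (x : Coord) : ℝ :=
  u.dir k.succ (T i j) x - ∑ l, u.lc k.succ l.succ i.succ x * T l j x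
    - ∑ l, u.lc k.succ l.succ j.succ x * T i l x

/-- Symmetrisation `M_{(ij)}`. -/
def symm (M : Fin 3 → Fin 3 → ℝ) (i j : Fin 3) : ℝ := (1 / 2) * (M i j + M j i)

/-- `ε^{kl}{}_{(j} D_{|l|} T_{i)k}`. -/
def curl (T : Fin 3 → Fin 3 → Coord → ℝ) (i j : Fin 3) (x : Coord) : ℝ :=
  symm (fun i j => ∑ k, ∑ l, eps3 k l j * u.covD T l i k x) i j

/-- `a_l ε^{kl}{}_{(j} T_{i)k}`. -/
def accCross (T : Fin 3 → Fin 3 → Coord → ℝ) (i j : Fin 3) (x : Coord) : ℝ :=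
  symm (fun i j => ∑ k, ∑ l, u.acc l x * eps3 k l j * T i k x) i j

/-- `-2 χ T_{ij} + 2 χ^k{}_{(i} T_{j)k} + χ_{(i}{}^k T_{j)k} - δ_{ij} χ^{kl} T_{kl}`. -/
def chiTerms (T : Fin 3 → Fin 3 → Coord → ℝ) (i j : Fin 3) (x : Coord) : ℝ :=
  -2 * u.trchi x * T i j x + 2 * symm (fun i j => ∑ k, u.chi k i x * T j k x) i j
    + symm (fun i j => ∑ k, u.chi i k x * T j k x) i j
    - kd i j * ∑ k, ∑ l, u.chi k l x * T k l x

/-- The conformal evolution equations on `U`. -/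
structure EvolutionEquations (Ξ : Coord → ℝ) (κ : Fin 4 → Coord → ℝ) (U : Set Coord) : Prop where
  frame : ∀ x ∈ U, ∀ b ν, pd 0 (u.e b ν) x = - ∑ c, u.Γ b c 0 x * u.e c ν x
  schouten : ∀ x ∈ U, ∀ d b,
    pd 0 (u.L d b) x = - ∑ c, u.Γ d c 0 x * u.L c b x + ∑ a, κ a x * u.d a b 0 d x
  covector : ∀ x ∈ U, ∀ i : Fin 3,
    pd 0 (u.f i.succ) x = - ∑ j : Fin 3, u.f j.succ x * u.Γ i.succ j.succ 0 x + u.L i.succ 0 x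
  connection : ∀ x ∈ U, ∀ b c d,
    pd 0 (u.Γ b c d) x = - ∑ g, u.Γ g c d x * u.Γ b g 0 x + Ξ x * u.d c d 0 b x
      + kd d c * u.L b 0 x + kd 0 c * u.L b d x - eta d 0 * ∑ g, eta c g * u.L b g x
  electric : ∀ x ∈ U, ∀ i j : Fin 3,
    pd 0 (u.el i j) x + u.curl u.mag i j x
      = -2 * u.accCross u.mag i j x + u.chiTerms u.el i j x
  magnetic : ∀ x ∈ U, ∀ i j : Fin 3,
    pd 0 (u.mag i j) x - u.curl u.el i j x
      = 2 * u.accCross u.el i j x + u.chiTerms u.mag i j x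

end Fields

/-! ### Independent components -/

/-- Index set of the independent frame coefficients `e_i{}^μ`. -/
abbrev FrameIdx : Type := Fin 3 × Fin 4

/-- Index set of the independent connection coefficients: `Γ̂_i{}^j{}_0`; the antisymmetric part of
`Γ̂_i{}^j{}_k`, i.e. `Γ̂_i{}^2{}_3`, `Γ̂_i{}^3{}_1`, `Γ̂_i{}^1{}_2`; and `f_i`. -/
abbrev ConnIdx : Type := (Fin 3 × Fin 3) ⊕ (Fin 3 × Fin 3) ⊕ Fin 3

/-- Index set of the independent components `L̂_{ia}`. -/
abbrev SchoutenIdx : Type := Fin 3 × Fin 4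

/-- Index set of `υ = (e, Γ, L)`. -/
abbrev UpsIdx : Type := FrameIdx ⊕ ConnIdx ⊕ SchoutenIdx

/-- Index set of `φ = (d, d*)`. -/
abbrev PhiIdx : Type := Fin 5 ⊕ Fin 5

namespace Fields

variable (u : Fields)

/-- The independent frame coefficients. -/
def frameVec (x : Coord) : FrameIdx → ℝ := fun p => u.e p.1.succ p.2 x

/-- The independent connection coefficients (in the second family `k + 1`, `k + 2` are taken
cyclically in `Fin 3`). -/
def connVec (x : Coord) : ConnIdx → ℝ :=
  Sum.elim (fun p => u.Γ p.1.succ p.2.succ 0 x)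
    (Sum.elim (fun p => u.Γ p.1.succ (p.2 + 1).succ (p.2 + 2).succ x) (fun i => u.f i.succ x))

/-- The independent Schouten components. -/
def schoutenVec (x : Coord) : SchoutenIdx → ℝ := fun p => u.L p.1.succ p.2 x

/-- `υ = (e, Γ, L)`. -/
def upsilon (x : Coord) : UpsIdx → ℝ :=
  Sum.elim (u.frameVec x) (Sum.elim (u.connVec x) (u.schoutenVec x))

/-- The five independent components of a symmetric trace-free spatial tensor, with respect to a
basis that is orthonormal for `⟨S, T⟩ = S_{ij} T_{ij}`. -/
def stf (T : Fin 3 → Fin 3 → ℝ) : Fin 5 → ℝ :=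
  ![(T 0 0 - T 1 1) / √2, √(3 / 2) * T 2 2, √2 * T 0 1, √2 * T 0 2, √2 * T 1 2]

/-- `φ = (d, d*)`. -/
def phi (x : Coord) : PhiIdx → ℝ :=
  Sum.elim (stf fun i j => u.el i j x) (stf fun i j => u.mag i j x)

/-- The system `∂_τ υ = K υ + Q(Γ) υ + L(x) φ`,
`(1 + A⁰(e)) ∂_τ φ + A^α(e) ∂_α φ = B(Γ) φ` on `U`. -/
structure HyperbolicSystem (K : Matrix UpsIdx UpsIdx ℝ)
    (Q : (ConnIdx → ℝ) → Matrix UpsIdx UpsIdx ℝ) (Lm : Coord → Matrix UpsIdx PhiIdx ℝ)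
    (A : Fin 4 → (FrameIdx → ℝ) → Matrix PhiIdx PhiIdx ℝ)
    (B : (ConnIdx → ℝ) → Matrix PhiIdx PhiIdx ℝ) (U : Set Coord) : Prop where
  ode : ∀ x ∈ U, (fun I => pd 0 (fun y => u.upsilon y I) x)
    = K *ᵥ u.upsilon x + Q (u.connVec x) *ᵥ u.upsilon x + Lm x *ᵥ u.phi x
  pde : ∀ x ∈ U,
    (1 + A 0 (u.frameVec x)) *ᵥ (fun I => pd 0 (fun y => u.phi y I) x)
      + ∑ α : Fin 3, A α.succ (u.frameVec x) *ᵥ (fun I => pd α.succ (fun y => u.phi y I) x)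
    = B (u.connVec x) *ᵥ u.phi x

end Fields

end XCFE

end

/-!
In the gauge `e_0 = ∂_τ`, `Γ̂_0{}^a{}_b = 0`, `L̂_{0a} = 0` the components of the torsion,
curvature and Schouten equations with one index equal to `0` contain no derivative except `∂_τ`,
and they are the transport equations for `e`, `Γ̂` and `L̂`; the equation for `f` is a trace of
the one for `Γ̂` (`frame_evolution`, `connection_evolution`, `schouten_evolution`,
`covector_evolution`).

For the Bianchi equation the point is that a Weyl tensor is the same thing as a pair of symmetric
trace-free spatial tensors, its electric and magnetic parts (`IsWeylTensor.eq_weylOf`). Since the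
rescaled Weyl tensor is such a pair at every point of an open set, so is each of its derivatives,
and the equation `∇̂_a d^a{}_{bcd} = f_a d^a{}_{bcd}` becomes one for spatial tensors. The
symmetric part of its components `i0j`, and the symmetric part of the duals of its components
`ikl`, are the evolution equations (`evolution_eq_zeroLambda`).

For the equivalence with the hyperbolic system, the metric condition on `Γ̂` and the symmetries of
the Weyl tensor express the dependent components through the independent ones, and the evolution
equations of the dependent components follow from those of the independent ones (`transport_iff`).
Both sides of the Bianchi evolution equations are symmetric and trace-free, so they may be paired
with an orthonormal basis of such tensors (`pde_iff`). The coefficient matrices depend on `e` and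
`Γ` linearly, which makes them smooth.

The principal part is built from the symbol `T ↦ ε^{kl}{}_{(j} ξ_{|l|} T_{i)k}` of the curl. It is
antisymmetric (`symbolMatrix_transpose`) and enters the two equations with opposite signs, whence
the matrices `A^μ` are symmetric. Apart from the symmetrisation, which is a contraction, the
symbol is the vector product with `ξ` on each row of `T`, so that its norm is at most `|ξ|`; for
`ξ_i = e_i{}^0` this gives positivity of `1 + A⁰` when `|ξ| < 1` (`posDef_one_add_principal`).
-/

noncomputable section

namespace XCFE

/-! ### Volume forms -/

theorem eps3_eq (i j k : Fin 3) : eps3 i j k =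
    kd i 0 * (kd j 1 * kd k 2 - kd j 2 * kd k 1) - kd i 1 * (kd j 0 * kd k 2 - kd j 2 * kd k 0)
      + kd i 2 * (kd j 0 * kd k 1 - kd j 1 * kd k 0) := by
  simp only [eps3, perm, Matrix.det_fin_three, Matrix.of_apply]
  simp; ring

theorem eps3_swap_left (i j k : Fin 3) : eps3 j i k = -eps3 i j k := by
  simp only [eps3_eq]; ring

theorem eps4_succ_zero (i j k : Fin 3) : eps4 i.succ 0 j.succ k.succ = eps3 i j k := by
  rw [eps3_eq]
  simp only [eps4, perm]
  rw [Matrix.det_succ_row _ 1]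
  simp [Fin.sum_univ_succ, Matrix.det_fin_three, kd, Fin.succAbove]
  fin_cases i <;> fin_cases j <;> fin_cases k <;> simp

theorem eps4_succ_zero_zero (i : Fin 3) (n : Fin 4) : eps4 i.succ 0 0 n = 0 := by
  simp only [eps4, perm, neg_eq_zero]
  exact Matrix.det_zero_of_row_eq (i := 1) (j := 2) (by decide) (by ext; simp)

theorem eps4_succ_zero_zero' (i : Fin 3) (m : Fin 4) : eps4 i.succ 0 m 0 = 0 := by
  simp only [eps4, perm, neg_eq_zero]
  exact Matrix.det_zero_of_row_eq (i := 1) (j := 3) (by decide) (by ext; simp)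

theorem sum_eta_mul (a : Fin 4) (F : Fin 4 → ℝ) : ∑ g, eta a g * F g = eta a a * F a := by
  rw [Finset.sum_eq_single a] <;> simp +contextual [eta, eq_comm]

theorem sum_kd_mul {n : ℕ} (a : Fin n) (F : Fin n → ℝ) : ∑ b, kd a b * F b = F a := by
  simp [kd]

theorem kd_comm {n : ℕ} (a b : Fin n) : kd a b = kd b a := by
  simp [kd, eq_comm]

theorem kd_cyclic (k : Fin 3) : (kd (k + 1) (k + 2) : ℝ) = 0 := by
  fin_cases k <;> simp [kd]

theorem kd_succ_succ {n : ℕ} (i j : Fin n) : kd i.succ j.succ = kd i j := by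
  simp [kd]

theorem eta_succ_succ (i j : Fin 3) : eta i.succ j.succ = kd i j := by
  simp [eta, kd, Fin.succ_ne_zero]

theorem sum_eps3_cyclic (k : Fin 3) (F : Fin 3 → ℝ) : ∑ m, eps3 (k + 1) (k + 2) m * F m = F k := by
  fin_cases k <;> simp [eps3_eq, kd]

/-- An antisymmetric spatial matrix is the dual of its axial vector. -/
theorem eq_sum_eps3_of_antisymm {v : Fin 3 → Fin 3 → ℝ} (h : ∀ i j, v i j = -v j i)
    (i j : Fin 3) : v i j = ∑ m, eps3 i j m * v (m + 1) (m + 2) := by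
  have h00 := h 0 0
  have h11 := h 1 1
  have h22 := h 2 2
  have h10 := h 1 0
  have h21 := h 2 1
  have h20 := h 2 0
  fin_cases i <;> fin_cases j <;> simp [eps3_eq, kd] <;> linarith

/-! ### Weyl tensors and their electric and magnetic parts -/

/-- The algebraic symmetries of a Weyl tensor, all indices lowered. -/
structure IsWeylTensor (w : Fin 4 → Fin 4 → Fin 4 → Fin 4 → ℝ) : Prop where
  antisymm_left : ∀ a b c g, w a b c g = -w b a c g
  antisymm_right : ∀ a b c g, w a b c g = -w a b g c
  pair_symm : ∀ a b c g, w a b c g = w c g a b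
  cyclic : ∀ a b c g, w a b c g + w a c g b + w a g b c = 0
  trace_free : ∀ b g, ∑ a, eta a a * w a b a g = 0

/-- The electric part `w_{i0j0}`. -/
def elPart (w : Fin 4 → Fin 4 → Fin 4 → Fin 4 → ℝ) (i j : Fin 3) : ℝ := w i.succ 0 j.succ 0

/-- The magnetic part `½ ε_{imn} w_{mnj0}`, written without the sum over the two equal terms:
`i + 1` and `i + 2` are taken cyclically in `Fin 3`. -/
def magPart (w : Fin 4 → Fin 4 → Fin 4 → Fin 4 → ℝ) (i j : Fin 3) : ℝ :=
  w (i + 1).succ (i + 2).succ j.succ 0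

/-- Symmetric trace-free spatial tensors. -/
structure IsSTF (T : Fin 3 → Fin 3 → ℝ) : Prop where
  symm : ∀ i j, T i j = T j i
  trace : ∑ i, T i i = 0

theorem IsSTF.normal_form {T : Fin 3 → Fin 3 → ℝ} (hT : IsSTF T) :
    T 1 0 = T 0 1 ∧ T 2 0 = T 0 2 ∧ T 2 1 = T 1 2 ∧ T 2 2 = -T 0 0 - T 1 1 := by
  have h := hT.trace
  rw [Fin.sum_univ_three] at h
  exact ⟨hT.symm 1 0, hT.symm 2 0, hT.symm 2 1, by linarith⟩

/-- The component along `e_i ∧ e_0` of the bivector `e_a ∧ e_b`. -/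
def boostPart (a b : Fin 4) (i : Fin 3) : ℝ := kd a i.succ * kd b 0 - kd a 0 * kd b i.succ

/-- The component along the dual of `e_i ∧ e_0` of the bivector `e_a ∧ e_b`. -/
def rotPart (a b : Fin 4) (i : Fin 3) : ℝ :=
  ∑ j : Fin 3, ∑ k : Fin 3, eps3 j k i * (kd a j.succ * kd b k.succ)

/-- The Weyl tensor with electric part `E` and magnetic part `B`, as a symmetric
bilinear form on bivectors. -/
def weylOf (E B : Fin 3 → Fin 3 → ℝ) (a b c g : Fin 4) : ℝ :=
  ∑ i, ∑ j, ((boostPart a b i * boostPart c g j - rotPart a b i * rotPart c g j) * E i j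
    + (boostPart a b i * rotPart c g j + rotPart a b i * boostPart c g j) * B i j)

@[simp] theorem boostPart_zero_zero (i : Fin 3) : boostPart 0 0 i = 0 := by
  simp only [boostPart]; ring

@[simp] theorem boostPart_succ_zero (i j : Fin 3) : boostPart i.succ 0 j = kd i j := by
  simp [boostPart, kd]

@[simp] theorem boostPart_zero_succ (i j : Fin 3) : boostPart 0 i.succ j = -kd i j := by
  simp [boostPart, kd]

@[simp] theorem boostPart_succ_succ (i j k : Fin 3) : boostPart i.succ j.succ k = 0 := by
  simp [boostPart, kd]

@[simp] theorem rotPart_zero_left (a : Fin 4) (i : Fin 3) : rotPart 0 a i = 0 := by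
  simp [rotPart, kd, Fin.succ_ne_zero, eq_comm]

@[simp] theorem rotPart_zero_right (a : Fin 4) (i : Fin 3) : rotPart a 0 i = 0 := by
  simp [rotPart, kd, Fin.succ_ne_zero, eq_comm]

@[simp] theorem rotPart_succ_succ (i j k : Fin 3) : rotPart i.succ j.succ k = eps3 i j k := by
  simp [rotPart, kd]

section components

variable (E B : Fin 3 → Fin 3 → ℝ)

theorem weylOf_swap_left (a b c g : Fin 4) : weylOf E B b a c g = -weylOf E B a b c g := by
  have h1 : ∀ i, boostPart b a i = -boostPart a b i := fun i => by simp only [boostPart]; ring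
  have h2 : ∀ i, rotPart b a i = -rotPart a b i := fun i => by
    simp only [rotPart]
    rw [Finset.sum_comm]
    simp only [← Finset.sum_neg_distrib]
    refine Finset.sum_congr rfl fun j _ => Finset.sum_congr rfl fun k _ => ?_
    rw [eps3_swap_left]; ring
  simp only [weylOf, h1, h2, ← Finset.sum_neg_distrib]
  refine Finset.sum_congr rfl fun j _ => Finset.sum_congr rfl fun k _ => ?_
  ring

theorem weylOf_swap_right (a b c g : Fin 4) : weylOf E B a b g c = -weylOf E B a b c g := by
  have h1 : ∀ i, boostPart g c i = -boostPart c g i := fun i => by simp only [boostPart]; ring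
  have h2 : ∀ i, rotPart g c i = -rotPart c g i := fun i => by
    simp only [rotPart]
    rw [Finset.sum_comm]
    simp only [← Finset.sum_neg_distrib]
    refine Finset.sum_congr rfl fun j _ => Finset.sum_congr rfl fun k _ => ?_
    rw [eps3_swap_left]; ring
  simp only [weylOf, h1, h2, ← Finset.sum_neg_distrib]
  refine Finset.sum_congr rfl fun j _ => Finset.sum_congr rfl fun k _ => ?_
  ring

theorem weylOf_zero_zero_left (a b : Fin 4) : weylOf E B 0 0 a b = 0 := by
  simp [weylOf]

theorem weylOf_zero_zero_right (a b : Fin 4) : weylOf E B a b 0 0 = 0 := by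
  simp [weylOf]

theorem weylOf_succ_zero_succ_zero (i j : Fin 3) :
    weylOf E B i.succ 0 j.succ 0 = E i j := by
  simp [weylOf, kd]

theorem weylOf_succ_succ_succ_zero (i j k : Fin 3) :
    weylOf E B i.succ j.succ k.succ 0 = ∑ m, eps3 i j m * B m k := by
  simp [weylOf, kd]

theorem weylOf_succ_zero_succ_succ (i j k : Fin 3) :
    weylOf E B i.succ 0 j.succ k.succ = ∑ m, eps3 j k m * B i m := by
  simp [weylOf, kd]

theorem weylOf_succ_succ_succ_succ (i j k l : Fin 3) :
    weylOf E B i.succ j.succ k.succ l.succ = -∑ m, ∑ n, eps3 i j m * eps3 k l n * E m n := by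
  simp [weylOf]

theorem weylOf_zero_succ_succ_zero (i j : Fin 3) :
    weylOf E B 0 i.succ j.succ 0 = -E i j := by
  rw [weylOf_swap_left, weylOf_succ_zero_succ_zero]

theorem weylOf_succ_zero_zero_succ (i j : Fin 3) :
    weylOf E B i.succ 0 0 j.succ = -E i j := by
  rw [weylOf_swap_right, weylOf_succ_zero_succ_zero]

theorem weylOf_zero_succ_zero_succ (i j : Fin 3) :
    weylOf E B 0 i.succ 0 j.succ = E i j := by
  rw [weylOf_swap_left, weylOf_succ_zero_zero_succ, neg_neg]

theorem weylOf_succ_succ_zero_succ (i j k : Fin 3) :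
    weylOf E B i.succ j.succ 0 k.succ = -∑ m, eps3 i j m * B m k := by
  rw [weylOf_swap_right, weylOf_succ_succ_succ_zero]

theorem weylOf_zero_succ_succ_succ (i j k : Fin 3) :
    weylOf E B 0 i.succ j.succ k.succ = -∑ m, eps3 j k m * B i m := by
  rw [weylOf_swap_left, weylOf_succ_zero_succ_succ]

end components

namespace IsWeylTensor

variable {w : Fin 4 → Fin 4 → Fin 4 → Fin 4 → ℝ}

theorem self_left (hw : IsWeylTensor w) (a c g : Fin 4) : w a a c g = 0 := by
  linarith [hw.antisymm_left a a c g]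

theorem self_right (hw : IsWeylTensor w) (a b c : Fin 4) : w a b c c = 0 := by
  linarith [hw.antisymm_right a b c c]

theorem isSTF_elPart (hw : IsWeylTensor w) : IsSTF (elPart w) where
  symm i j := hw.pair_symm _ _ _ _
  trace := by
    have h := hw.trace_free 0 0
    rw [Fin.sum_univ_succ, hw.self_left] at h
    simpa [eta, Fin.succ_ne_zero, elPart] using h

theorem trace_succ_zero (hw : IsWeylTensor w) (j : Fin 3) :
    ∑ i : Fin 3, w j.succ i.succ i.succ 0 = 0 := by
  have h := hw.trace_free j.succ 0
  rw [Fin.sum_univ_succ, hw.self_right] at h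
  simp only [eta, Fin.succ_ne_zero, if_true, if_false, mul_zero, zero_add, one_mul] at h
  rw [← neg_eq_zero, ← h, ← Finset.sum_neg_distrib]
  exact Finset.sum_congr rfl fun i _ => by rw [hw.antisymm_left]; ring

theorem trace_succ_succ (hw : IsWeylTensor w) (j l : Fin 3) :
    ∑ i : Fin 3, w i.succ j.succ i.succ l.succ = elPart w j l := by
  have h := hw.trace_free j.succ l.succ
  rw [Fin.sum_univ_succ, hw.antisymm_left 0, hw.antisymm_right _ 0] at h
  simp only [eta, Fin.succ_ne_zero, if_true, if_false, one_mul] at h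
  rw [elPart]
  linarith

theorem isSTF_magPart (hw : IsWeylTensor w) : IsSTF (magPart w) where
  symm i j := by
    have h0 := hw.trace_succ_zero 0
    have h1 := hw.trace_succ_zero 1
    have h2 := hw.trace_succ_zero 2
    simp only [Fin.sum_univ_three, hw.self_left] at h0 h1 h2
    have a1 := hw.antisymm_left (Fin.succ 1) (Fin.succ 0) (Fin.succ 1) 0
    have a2 := hw.antisymm_left (Fin.succ 2) (Fin.succ 0) (Fin.succ 0) 0
    have a3 := hw.antisymm_left (Fin.succ 2) (Fin.succ 1) (Fin.succ 1) 0
    have a4 := hw.antisymm_left (Fin.succ 1) (Fin.succ 0) (Fin.succ 0) 0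
    have a5 := hw.antisymm_left (Fin.succ 2) (Fin.succ 0) (Fin.succ 2) 0
    have a6 := hw.antisymm_left (Fin.succ 2) (Fin.succ 1) (Fin.succ 2) 0
    fin_cases i <;> fin_cases j <;> simp [magPart] at * <;> linarith
  trace := by
    have h := hw.cyclic (Fin.succ 0) (Fin.succ 1) (Fin.succ 2) 0
    rw [hw.pair_symm _ 0, hw.antisymm_right _ _ 0, hw.antisymm_left (Fin.succ 0) (Fin.succ 2)] at h
    simp [Fin.sum_univ_three, magPart] at *
    linarith

/-- In three dimensions the purely spatial components are determined by their trace, hence by the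
electric part. -/
theorem spatial_eq (hw : IsWeylTensor w) (m n : Fin 3) :
    w (m + 1).succ (m + 2).succ (n + 1).succ (n + 2).succ = -elPart w m n := by
  have hE := hw.isSTF_elPart
  have h := hw.trace_succ_succ
  have h00 := h 0 0
  have h01 := h 0 1
  have h02 := h 0 2
  have h11 := h 1 1
  have h12 := h 1 2
  have h22 := h 2 2
  have t := hE.trace
  have s := hE.symm
  have s01 := s 1 0
  have s02 := s 2 0
  have s12 := s 2 1
  simp only [Fin.sum_univ_three, hw.self_left, hw.self_right] at h00 h01 h02 h11 h12 h22 t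
  have l := hw.antisymm_left
  have r := hw.antisymm_right
  have p := hw.pair_symm
  fin_cases m <;> fin_cases n <;> simp at *
  · linarith [l 2 1 2 1, r 1 2 2 1, l 3 1 3 1, r 1 3 3 1, l 3 2 3 2, r 2 3 3 2]
  · linarith [p 2 3 3 1, r 3 1 2 3]
  · linarith [p 2 3 1 2, l 1 2 2 3]
  · linarith [r 3 1 2 3]
  · linarith [l 2 1 2 1, r 1 2 2 1, l 3 1 3 1, r 1 3 3 1, l 3 2 3 2, r 2 3 3 2]
  · linarith [p 3 1 1 2, r 1 2 3 1]
  · linarith [l 1 2 2 3]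
  · linarith [r 1 2 3 1]
  · linarith [l 2 1 2 1, r 1 2 2 1, l 3 1 3 1, r 1 3 3 1, l 3 2 3 2, r 2 3 3 2]

/-- A Weyl tensor is determined by its electric and magnetic parts. -/
theorem eq_weylOf (hw : IsWeylTensor w) (a b c g : Fin 4) :
    w a b c g = weylOf (elPart w) (magPart w) a b c g := by
  have mix : ∀ i j k : Fin 3, w i.succ j.succ k.succ 0 =
      weylOf (elPart w) (magPart w) i.succ j.succ k.succ 0 := fun i j k => by
    rw [weylOf_succ_succ_succ_zero]
    exact eq_sum_eps3_of_antisymm (v := fun i j => w i.succ j.succ k.succ 0)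
      (fun i j => hw.antisymm_left _ _ _ _) i j
  have mix' : ∀ i j k : Fin 3, w i.succ 0 j.succ k.succ =
      weylOf (elPart w) (magPart w) i.succ 0 j.succ k.succ := fun i j k => by
    rw [hw.pair_symm, mix, weylOf_succ_succ_succ_zero, weylOf_succ_zero_succ_succ]
    simp only [hw.isSTF_magPart.symm i]
  have spat : ∀ i j k l : Fin 3, w i.succ j.succ k.succ l.succ =
      weylOf (elPart w) (magPart w) i.succ j.succ k.succ l.succ := fun i j k l => by
    rw [weylOf_succ_succ_succ_succ,
      eq_sum_eps3_of_antisymm (v := fun i j => w i.succ j.succ k.succ l.succ)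
        (fun i j => hw.antisymm_left _ _ _ _) i j, ← Finset.sum_neg_distrib]
    refine Finset.sum_congr rfl fun m _ => ?_
    rw [eq_sum_eps3_of_antisymm (v := fun k l => w (m + 1).succ (m + 2).succ k.succ l.succ)
        (fun i j => hw.antisymm_right _ _ _ _) k l, Finset.mul_sum, ← Finset.sum_neg_distrib]
    refine Finset.sum_congr rfl fun n _ => ?_
    rw [hw.spatial_eq]; ring
  induction a using Fin.cases with
  | zero =>
    induction b using Fin.cases with
    | zero => rw [hw.self_left, weylOf_zero_zero_left]
    | succ j =>
      rw [hw.antisymm_left, weylOf_swap_left]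
      congr 1
      induction c using Fin.cases with
      | zero =>
        induction g using Fin.cases with
        | zero => rw [hw.self_right, weylOf_zero_zero_right]
        | succ l =>
          rw [hw.antisymm_right, weylOf_swap_right, weylOf_succ_zero_succ_zero, elPart]
      | succ k =>
        induction g using Fin.cases with
        | zero => rw [weylOf_succ_zero_succ_zero, elPart]
        | succ l => exact mix' j k l
  | succ i =>
    induction b using Fin.cases with
    | zero =>
      induction c using Fin.cases with
      | zero =>
        induction g using Fin.cases with
        | zero => rw [hw.self_right, weylOf_zero_zero_right]
        | succ l =>
          rw [hw.antisymm_right, weylOf_swap_right, weylOf_succ_zero_succ_zero, elPart]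
      | succ k =>
        induction g using Fin.cases with
        | zero => rw [weylOf_succ_zero_succ_zero, elPart]
        | succ l => exact mix' i k l
    | succ j =>
      induction c using Fin.cases with
      | zero =>
        induction g using Fin.cases with
        | zero => rw [hw.self_right, weylOf_zero_zero_right]
        | succ l => rw [hw.antisymm_right, weylOf_swap_right, mix]
      | succ k =>
        induction g using Fin.cases with
        | zero => exact mix i j k
        | succ l => exact spat i j k l

end IsWeylTensor

/-! ### Partial derivatives -/

open Filter Topology in
theorem pd_congr {f g : Coord → ℝ} {x : Coord} (h : f =ᶠ[𝓝 x] g) (μ : Fin 4) :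
    pd μ f x = pd μ g x := by
  rw [pd, pd, h.fderiv_eq]

theorem pd_congr_of_isOpen {f g : Coord → ℝ} {U : Set Coord} (hU : IsOpen U)
    (h : ∀ y ∈ U, f y = g y) {x : Coord} (hx : x ∈ U) (μ : Fin 4) : pd μ f x = pd μ g x :=
  pd_congr (Filter.eventuallyEq_of_mem (hU.mem_nhds hx) h) μ

theorem pd_const (μ : Fin 4) (c : ℝ) (x : Coord) : pd μ (fun _ => c) x = 0 := by
  simp [pd]

theorem pd_eq_zero_of_const {F : Coord → ℝ} {c : ℝ} {U : Set Coord} (hU : IsOpen U)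
    (hF : ∀ y ∈ U, F y = c) {x : Coord} (hx : x ∈ U) (μ : Fin 4) : pd μ F x = 0 := by
  rw [pd_congr_of_isOpen hU hF hx, pd_const]

theorem pd_const_mul {f : Coord → ℝ} {x : Coord} (hf : DifferentiableAt ℝ f x) (μ : Fin 4)
    (c : ℝ) : pd μ (fun y => c * f y) x = c * pd μ f x := by
  simp [pd, fderiv_const_mul hf]

theorem pd_add {f g : Coord → ℝ} {x : Coord} (hf : DifferentiableAt ℝ f x)
    (hg : DifferentiableAt ℝ g x) (μ : Fin 4) :
    pd μ (fun y => f y + g y) x = pd μ f x + pd μ g x := by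
  simp [pd, fderiv_fun_add hf hg]

theorem pd_sum {ι : Type*} {s : Finset ι} {f : ι → Coord → ℝ} {x : Coord}
    (hf : ∀ i ∈ s, DifferentiableAt ℝ (f i) x) (μ : Fin 4) :
    pd μ (fun y => ∑ i ∈ s, f i y) x = ∑ i ∈ s, pd μ (f i) x := by
  simp [pd, fderiv_fun_sum hf]

namespace Fields

variable {u : Fields} {U : Set Coord} {x : Coord}

/-! ### Electric and magnetic components of the rescaled Weyl tensor -/

theorem dlow_eq (a b c g : Fin 4) (x : Coord) :
    u.dlow a b c g x = eta a a * u.d a b c g x :=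
  sum_eta_mul a _

theorem d_eq_dlow (a b c g : Fin 4) (x : Coord) :
    u.d a b c g x = eta a a * u.dlow a b c g x := by
  rw [dlow_eq, ← mul_assoc]
  simp only [eta, if_true]
  split_ifs <;> ring

theorem IsConfiguration.isWeylTensor (hc : u.IsConfiguration U) (hx : x ∈ U) :
    IsWeylTensor fun a b c g => u.dlow a b c g x where
  antisymm_left := hc.antisymm_left x hx
  antisymm_right := hc.antisymm_right x hx
  pair_symm := hc.pair_symm x hx
  cyclic := hc.cyclic x hx
  trace_free b g := by
    rw [← hc.trace_free x hx b g]
    exact Finset.sum_congr rfl fun a _ => (d_eq_dlow a b a g x).symm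

/-- Only spatial `m`, `n` contribute to `ε_{i0}{}^{mn}`, and there the signs of `η` are trivial. -/
theorem mag_eq_sum (i j : Fin 3) (x : Coord) : u.mag i j x =
    (1 / 2) * ∑ m : Fin 3, ∑ n : Fin 3, eps3 i m n * u.dlow m.succ n.succ j.succ 0 x := by
  simp only [mag, dstar, Fin.sum_univ_succ (n := 3), eps4_succ_zero, eps4_succ_zero_zero,
    eps4_succ_zero_zero']
  simp [eta, Fin.succ_ne_zero]

theorem IsConfiguration.mag_eq (hc : u.IsConfiguration U) (hx : x ∈ U) (i j : Fin 3) :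
    u.mag i j x = magPart (fun a b c g => u.dlow a b c g x) i j := by
  rw [mag_eq_sum]
  have h := hc.antisymm_left x hx
  have h1 := h (Fin.succ 1) (Fin.succ 0) j.succ 0
  have h2 := h (Fin.succ 2) (Fin.succ 0) j.succ 0
  have h3 := h (Fin.succ 2) (Fin.succ 1) j.succ 0
  fin_cases i <;> simp [Fin.sum_univ_three, eps3_eq, kd, magPart] at * <;> linarith

theorem IsConfiguration.isSTF_el (hc : u.IsConfiguration U) (hx : x ∈ U) :
    IsSTF fun i j => u.el i j x :=
  (hc.isWeylTensor hx).isSTF_elPart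

theorem IsConfiguration.isSTF_mag (hc : u.IsConfiguration U) (hx : x ∈ U) :
    IsSTF fun i j => u.mag i j x := by
  simp only [hc.mag_eq hx]
  exact (hc.isWeylTensor hx).isSTF_magPart

theorem IsConfiguration.d_eq (hc : u.IsConfiguration U) (hx : x ∈ U) (a b c g : Fin 4) :
    u.d a b c g x =
      eta a a * weylOf (fun i j => u.el i j x) (fun i j => u.mag i j x) a b c g := by
  simp only [d_eq_dlow, hc.mag_eq hx]
  congr 1
  exact (hc.isWeylTensor hx).eq_weylOf a b c g

theorem IsConfiguration.differentiableAt_dlow (hc : u.IsConfiguration U) (hU : IsOpen U)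
    (hx : x ∈ U) (a b c g : Fin 4) : DifferentiableAt ℝ (u.dlow a b c g) x := by
  have h : ∀ h, DifferentiableAt ℝ (u.d h b c g) x := fun h =>
    ((hc.smooth_d h b c g).differentiableOn one_ne_zero).differentiableAt (hU.mem_nhds hx)
  have h' : u.dlow a b c g = fun y => eta a a * u.d a b c g y := funext (dlow_eq a b c g)
  rw [h']
  exact (h a).const_mul _

theorem IsConfiguration.differentiableAt_el (hc : u.IsConfiguration U) (hU : IsOpen U)
    (hx : x ∈ U) (i j : Fin 3) : DifferentiableAt ℝ (u.el i j) x :=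
  hc.differentiableAt_dlow hU hx _ _ _ _

theorem IsConfiguration.differentiableAt_mag (hc : u.IsConfiguration U) (hU : IsOpen U)
    (hx : x ∈ U) (i j : Fin 3) : DifferentiableAt ℝ (u.mag i j) x :=
  (hc.differentiableAt_dlow hU hx (i + 1).succ (i + 2).succ j.succ 0).congr_of_eventuallyEq
    (Filter.eventuallyEq_of_mem (hU.mem_nhds hx) fun _ hy => hc.mag_eq hy i j)

theorem IsConfiguration.pd_d_eq (hc : u.IsConfiguration U) (hU : IsOpen U) (hx : x ∈ U)
    (μ a b c g : Fin 4) : pd μ (u.d a b c g) x =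
      eta a a * weylOf (fun i j => pd μ (u.el i j) x) (fun i j => pd μ (u.mag i j) x) a b c g := by
  have hE := hc.differentiableAt_el hU hx
  have hB := hc.differentiableAt_mag hU hx
  have hE' : ∀ i j (r : ℝ), DifferentiableAt ℝ (fun y => r * u.el i j y) x :=
    fun i j r => (hE i j).const_mul r
  have hB' : ∀ i j (r : ℝ), DifferentiableAt ℝ (fun y => r * u.mag i j y) x :=
    fun i j r => (hB i j).const_mul r
  rw [pd_congr_of_isOpen hU (fun y hy => hc.d_eq hy a b c g) hx]
  simp only [weylOf]
  rw [pd_const_mul (by fun_prop), pd_sum (fun i _ => by fun_prop)]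
  congr 1
  refine Finset.sum_congr rfl fun i _ => ?_
  rw [pd_sum (fun j _ => by fun_prop)]
  refine Finset.sum_congr rfl fun j _ => ?_
  rw [pd_add (hE' _ _ _) (hB' _ _ _), pd_const_mul (hE _ _), pd_const_mul (hB _ _)]

theorem isSTF_pd {T : Fin 3 → Fin 3 → Coord → ℝ} (hU : IsOpen U) (hx : x ∈ U)
    (hd : ∀ i j, DifferentiableAt ℝ (T i j) x) (hT : ∀ y ∈ U, IsSTF fun i j => T i j y)
    (μ : Fin 4) : IsSTF fun i j => pd μ (T i j) x where
  symm i j := pd_congr_of_isOpen hU (fun y hy => (hT y hy).symm i j) hx μ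
  trace := by
    rw [← pd_sum (fun i _ => hd i i), pd_congr_of_isOpen hU (fun y hy => (hT y hy).trace) hx,
      pd_const]

theorem IsConfiguration.isSTF_pd_el (hc : u.IsConfiguration U) (hU : IsOpen U) (hx : x ∈ U)
    (μ : Fin 4) : IsSTF fun i j => pd μ (u.el i j) x :=
  isSTF_pd hU hx (hc.differentiableAt_el hU hx) (fun _ hy => hc.isSTF_el hy) μ

theorem IsConfiguration.isSTF_pd_mag (hc : u.IsConfiguration U) (hU : IsOpen U) (hx : x ∈ U)
    (μ : Fin 4) : IsSTF fun i j => pd μ (u.mag i j) x :=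
  isSTF_pd hU hx (hc.differentiableAt_mag hU hx) (fun _ hy => hc.isSTF_mag hy) μ

/-! ### The connection coefficients -/

theorem IsConfiguration.Γ_zero_zero (hc : u.IsConfiguration U) (hx : x ∈ U) (a : Fin 4) :
    u.Γ a 0 0 x = u.f a x := by
  have h := hc.weyl_connection x hx a 0 0
  simp [eta] at h
  linarith

theorem IsConfiguration.Γ_zero_succ (hc : u.IsConfiguration U) (hx : x ∈ U) (a : Fin 4)
    (j : Fin 3) : u.Γ a 0 j.succ x = u.Γ a j.succ 0 x := by
  have h := hc.weyl_connection x hx a 0 j.succ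
  simp [eta, Fin.succ_ne_zero, (Fin.succ_ne_zero _).symm] at h
  linarith

theorem IsConfiguration.Γ_succ_succ (hc : u.IsConfiguration U) (hx : x ∈ U) (a : Fin 4)
    (j k : Fin 3) : u.Γ a j.succ k.succ x = -u.Γ a k.succ j.succ x + 2 * (u.f a x * kd j k) := by
  have h := hc.weyl_connection x hx a j.succ k.succ
  simp [eta, Fin.succ_ne_zero] at h
  simp only [kd]
  split_ifs at h ⊢ <;> simp_all <;> linarith

/-- The spatial coefficients `Γ̂_a{}^j{}_k` are determined by their antisymmetric part and `f_a`. -/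
theorem IsConfiguration.Γ_succ_succ_eq_sum (hc : u.IsConfiguration U) (hx : x ∈ U) (a : Fin 4)
    (j k : Fin 3) : u.Γ a j.succ k.succ x =
      ∑ n : Fin 3, eps3 j k n * u.Γ a (n + 1).succ (n + 2).succ x + kd j k * u.f a x := by
  have h := eq_sum_eps3_of_antisymm
    (v := fun j k => u.Γ a j.succ k.succ x - kd j k * u.f a x) (fun j k => by
      have := hc.Γ_succ_succ hx a j k
      rw [kd_comm k j]; linarith) j k
  simp only [kd_cyclic, zero_mul, sub_zero] at h
  linarith

/-! ### The Bianchi equation in terms of the electric and magnetic parts -/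

theorem IsConfiguration.dir_d_eq (hc : u.IsConfiguration U) (hU : IsOpen U) (hx : x ∈ U)
    (h a b c g : Fin 4) : u.dir h (u.d a b c g) x =
      eta a a * weylOf (fun i j => u.dir h (u.el i j) x) (fun i j => u.dir h (u.mag i j) x)
        a b c g := by
  simp only [dir, hc.pd_d_eq hU hx, weylOf, Finset.mul_sum]
  rw [Finset.sum_comm]
  refine Finset.sum_congr rfl fun i _ => ?_
  rw [Finset.sum_comm]
  refine Finset.sum_congr rfl fun j _ => ?_
  rw [← Finset.sum_add_distrib, Finset.mul_sum]
  exact Finset.sum_congr rfl fun k _ => by ring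

theorem ConformalGaussianGauge.dir_zero (hg : u.ConformalGaussianGauge U) (hx : x ∈ U)
    (F : Coord → ℝ) : u.dir 0 F x = pd 0 F x := by
  simp only [dir, hg.time_leg x hx]
  exact sum_kd_mul 0 _

theorem acc_eq (hg : u.ConformalGaussianGauge U) (hx : x ∈ U) (i : Fin 3) :
    u.acc i x = -u.f i.succ x := by
  simp [acc, lc, hg.weyl_propagated x hx, tensorS, eta, kd, Fin.succ_ne_zero,
    (Fin.succ_ne_zero _).symm]

theorem chi_eq (hg : u.ConformalGaussianGauge U) (hx : x ∈ U) (i j : Fin 3) :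
    u.chi i j x = u.Γ i.succ j.succ 0 x := by
  have h : ∀ g, tensorS i.succ 0 j.succ g * u.f g x = 0 := fun g => by
    induction g using Fin.cases with
    | zero => simp [f_zero_of_gauge hg hx]
    | succ k => simp [tensorS, eta, kd, Fin.succ_ne_zero, (Fin.succ_ne_zero _).symm]
  simp [chi, lc, h]

theorem lc_succ_succ_succ (i j k : Fin 3) (x : Coord) : u.lc i.succ j.succ k.succ x =
    u.Γ i.succ j.succ k.succ x - kd i j * u.f k.succ x - kd k j * u.f i.succ x
      + kd i k * u.f j.succ x := by
  have h : ∀ g : Fin 3, tensorS i.succ k.succ j.succ g.succ * u.f g.succ x =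
      kd i j * (kd k g * u.f g.succ x) + kd k j * (kd i g * u.f g.succ x)
        - kd i k * (kd j g * u.f g.succ x) := fun g => by
    simp only [tensorS, eta_succ_succ, kd_succ_succ]
    ring
  simp only [lc, Fin.sum_univ_succ (n := 3), h, Finset.sum_add_distrib, Finset.sum_sub_distrib,
    ← Finset.mul_sum, sum_kd_mul]
  simp [tensorS, eta, kd, Fin.succ_ne_zero]
  ring

/-- The components `i0j` of the Bianchi equation, with all sums over spatial indices. -/
theorem zeroLambda_succ_zero_succ (hc : u.IsConfiguration U) (hg : u.ConformalGaussianGauge U)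
    (hU : IsOpen U) (hx : x ∈ U) (i j : Fin 3) : u.zeroLambda i.succ 0 j.succ x =
      -pd 0 (u.el i j) x - ∑ k : Fin 3, (∑ m, eps3 k i m * u.dir k.succ (u.mag m j) x
        + u.Γ k.succ k.succ 0 x * u.el i j x
        + ∑ l : Fin 3, u.Γ k.succ k.succ l.succ x * ∑ m, eps3 l i m * u.mag m j x
        - u.Γ k.succ i.succ 0 x * u.el k j x
        - ∑ l : Fin 3, u.Γ k.succ l.succ i.succ x * ∑ m, eps3 k l m * u.mag m j x
        - ∑ l : Fin 3, u.Γ k.succ l.succ 0 x *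
            ∑ m, ∑ n, eps3 k i m * eps3 l j n * u.el m n x
        - ∑ l : Fin 3, u.Γ k.succ l.succ j.succ x * ∑ m, eps3 k i m * u.mag m l x
        - 2 * (u.f k.succ x * ∑ m, eps3 k i m * u.mag m j x)) := by
  simp only [zeroLambda, covd, Fin.sum_univ_succ (n := 3), hc.dir_d_eq hU hx, hc.d_eq hx,
    hg.weyl_propagated x hx, hg.dir_zero hx, f_zero_of_gauge hg hx, weylOf_zero_zero_left,
    weylOf_zero_zero_right, weylOf_succ_succ_succ_succ, weylOf_succ_zero_zero_succ,
    weylOf_zero_succ_zero_succ, weylOf_succ_succ_zero_succ, weylOf_zero_succ_succ_succ,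
    hc.Γ_zero_zero hx, hc.Γ_zero_succ hx]
  simp only [eta, Fin.succ_ne_zero, if_true, if_false, zero_mul, mul_zero, Finset.sum_const_zero,
    one_mul, mul_neg, neg_mul, Finset.sum_neg_distrib, Finset.sum_add_distrib,
    Finset.sum_sub_distrib, two_mul]
  ring

/-- The components `ijk` of the Bianchi equation, with all sums over spatial indices. -/
theorem zeroLambda_succ_succ_succ (hc : u.IsConfiguration U) (hg : u.ConformalGaussianGauge U)
    (hU : IsOpen U) (hx : x ∈ U) (i j k : Fin 3) : u.zeroLambda i.succ j.succ k.succ x =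
      ∑ m, eps3 j k m * pd 0 (u.mag i m) x
        - ∑ h : Fin 3, (∑ m, ∑ n, eps3 h i m * eps3 j k n * u.dir h.succ (u.el m n) x
        - u.Γ h.succ h.succ 0 x * ∑ m, eps3 j k m * u.mag i m x
        + ∑ l : Fin 3, u.Γ h.succ h.succ l.succ x *
            ∑ m, ∑ n, eps3 l i m * eps3 j k n * u.el m n x
        + u.Γ h.succ i.succ 0 x * ∑ m, eps3 j k m * u.mag h m x
        - ∑ l : Fin 3, u.Γ h.succ l.succ i.succ x *
            ∑ m, ∑ n, eps3 h l m * eps3 j k n * u.el m n x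
        - u.Γ h.succ j.succ 0 x * ∑ m, eps3 h i m * u.mag m k x
        - ∑ l : Fin 3, u.Γ h.succ l.succ j.succ x *
            ∑ m, ∑ n, eps3 h i m * eps3 l k n * u.el m n x
        + u.Γ h.succ k.succ 0 x * ∑ m, eps3 h i m * u.mag m j x
        - ∑ l : Fin 3, u.Γ h.succ l.succ k.succ x *
            ∑ m, ∑ n, eps3 h i m * eps3 j l n * u.el m n x
        - u.f h.succ x * ∑ m, ∑ n, eps3 h i m * eps3 j k n * u.el m n x) := by
  simp only [zeroLambda, covd, Fin.sum_univ_succ (n := 3), hc.dir_d_eq hU hx, hc.d_eq hx,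
    hg.weyl_propagated x hx, hg.dir_zero hx, f_zero_of_gauge hg hx, weylOf_zero_zero_left,
    weylOf_succ_succ_succ_zero, weylOf_succ_zero_succ_succ, weylOf_succ_succ_succ_succ,
    weylOf_zero_succ_succ_zero, weylOf_zero_succ_zero_succ, weylOf_succ_succ_zero_succ,
    weylOf_zero_succ_succ_succ, hc.Γ_zero_succ hx]
  simp only [eta, Fin.succ_ne_zero, if_true, if_false, zero_mul, mul_zero, Finset.sum_const_zero,
    one_mul, mul_neg, neg_mul, neg_neg, Finset.sum_neg_distrib, Finset.sum_add_distrib,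
    Finset.sum_sub_distrib]
  ring

theorem isSTF_dir {T : Fin 3 → Fin 3 → Coord → ℝ} (h : ∀ μ, IsSTF fun i j => pd μ (T i j) x)
    (a : Fin 4) : IsSTF fun i j => u.dir a (T i j) x where
  symm i j := Finset.sum_congr rfl fun μ _ => by rw [(h μ).symm i j]
  trace := by
    simp only [dir]
    rw [Finset.sum_comm]
    exact Finset.sum_eq_zero fun μ _ => by rw [← Finset.mul_sum, (h μ).trace, mul_zero]

set_option maxHeartbeats 2000000 in
/-- The evolution equations of the electric and the magnetic part are the symmetric parts of the
components `i0j`, and of the duals of the components `ikl`, of the Bianchi equation. Once all terms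
are written with spatial indices this is an algebraic identity in the values at `x`. -/
theorem evolution_eq_zeroLambda (hc : u.IsConfiguration U) (hg : u.ConformalGaussianGauge U)
    (hU : IsOpen U) (hx : x ∈ U) (i j : Fin 3) :
    pd 0 (u.el i j) x + u.curl u.mag i j x
        - (-2 * u.accCross u.mag i j x + u.chiTerms u.el i j x) =
      -symm (fun i j => u.zeroLambda i.succ 0 j.succ x) i j ∧
    pd 0 (u.mag i j) x - u.curl u.el i j x
        - (2 * u.accCross u.el i j x + u.chiTerms u.mag i j x) =
      symm (fun i j => (1 / 2) * ∑ k, ∑ l, eps3 i k l * u.zeroLambda j.succ k.succ l.succ x)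
        i j := by
  have hE := hc.isSTF_el hx
  have hB := hc.isSTF_mag hx
  have htE := hc.isSTF_pd_el hU hx 0
  have htB := hc.isSTF_pd_mag hU hx 0
  have hdE : ∀ k : Fin 3, IsSTF fun i j => u.dir k.succ (u.el i j) x :=
    fun k => isSTF_dir (hc.isSTF_pd_el hU hx) _
  have hdB : ∀ k : Fin 3, IsSTF fun i j => u.dir k.succ (u.mag i j) x :=
    fun k => isSTF_dir (hc.isSTF_pd_mag hU hx) _
  have hγ : ∀ a j k : Fin 3, _ := fun a j k => hc.Γ_succ_succ hx a.succ j k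
  simp only [zeroLambda_succ_zero_succ hc hg hU hx, zeroLambda_succ_succ_succ hc hg hU hx, symm,
    curl, covD, accCross, chiTerms, trchi, chi_eq hg hx, acc_eq hg hx, lc_succ_succ_succ]
  -- From here on only the values at `x` matter: they are made independent of the fields.
  clear hc hg
  obtain ⟨E, e1⟩ : ∃ E : Fin 3 → Fin 3 → ℝ, ∀ i j, u.el i j x = E i j := ⟨_, fun _ _ => rfl⟩
  obtain ⟨B, e2⟩ : ∃ B : Fin 3 → Fin 3 → ℝ, ∀ i j, u.mag i j x = B i j := ⟨_, fun _ _ => rfl⟩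
  obtain ⟨tE, e3⟩ : ∃ E : Fin 3 → Fin 3 → ℝ, ∀ i j, pd 0 (u.el i j) x = E i j :=
    ⟨_, fun _ _ => rfl⟩
  obtain ⟨tB, e4⟩ : ∃ B : Fin 3 → Fin 3 → ℝ, ∀ i j, pd 0 (u.mag i j) x = B i j :=
    ⟨_, fun _ _ => rfl⟩
  obtain ⟨dE, e5⟩ : ∃ E : Fin 3 → Fin 3 → Fin 3 → ℝ,
    ∀ k i j, u.dir k.succ (u.el i j) x = E k i j := ⟨_, fun _ _ _ => rfl⟩
  obtain ⟨dB, e6⟩ : ∃ B : Fin 3 → Fin 3 → Fin 3 → ℝ,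
    ∀ k i j, u.dir k.succ (u.mag i j) x = B k i j := ⟨_, fun _ _ _ => rfl⟩
  obtain ⟨γ, e7⟩ : ∃ γ : Fin 3 → Fin 3 → Fin 3 → ℝ,
    ∀ k i j, u.Γ k.succ i.succ j.succ x = γ k i j := ⟨_, fun _ _ _ => rfl⟩
  obtain ⟨χ, e8⟩ : ∃ χ : Fin 3 → Fin 3 → ℝ, ∀ i j, u.Γ i.succ j.succ 0 x = χ i j :=
    ⟨_, fun _ _ => rfl⟩
  obtain ⟨f, e9⟩ : ∃ f : Fin 3 → ℝ, ∀ i, u.f i.succ x = f i := ⟨_, fun _ => rfl⟩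
  simp only [e1, e2, e3, e4, e5, e6, e7, e8, e9] at *
  clear e1 e2 e3 e4 e5 e6 e7 e8 e9
  obtain ⟨a1, a2, a3, a4⟩ := hE.normal_form
  obtain ⟨b1, b2, b3, b4⟩ := hB.normal_form
  obtain ⟨c1, c2, c3, -⟩ := htE.normal_form
  obtain ⟨d1, d2, d3, -⟩ := htB.normal_form
  have p1 := fun k => (hdE k).normal_form.1
  have p2 := fun k => (hdE k).normal_form.2.1
  have p3 := fun k => (hdE k).normal_form.2.2.1
  have p4 := fun k => (hdE k).normal_form.2.2.2
  have q1 := fun k => (hdB k).normal_form.1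
  have q2 := fun k => (hdB k).normal_form.2.1
  have q3 := fun k => (hdB k).normal_form.2.2.1
  have q4 := fun k => (hdB k).normal_form.2.2.2
  have w0 : ∀ k i, γ k i i = f k := fun k i => by
    have := hγ k i i
    simp only [kd, if_true] at this
    linarith
  have w1 : ∀ k, γ k 1 0 = -γ k 0 1 := fun k => by simpa [kd] using hγ k 1 0
  have w2 : ∀ k, γ k 2 0 = -γ k 0 2 := fun k => by simpa [kd] using hγ k 2 0
  have w3 : ∀ k, γ k 2 1 = -γ k 1 2 := fun k => by simpa [kd] using hγ k 2 1
  -- All values are now expressed by independent ones, and each of the components is checked.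
  clear hE hB htE htB hdE hdB hγ
  constructor
  · fin_cases i <;> fin_cases j <;>
      simp [Fin.sum_univ_three, eps3_eq, kd, a1, a2, a3, a4, b1, b2, b3, b4, c1, c2, c3, q1, q2,
        q3, q4, w0, w1, w2, w3] <;> ring
  · fin_cases i <;> fin_cases j <;>
      simp [Fin.sum_univ_three, eps3_eq, kd, a1, a2, a3, a4, b1, b2, b3, b4, d1, d2, d3, p1, p2,
        p3, p4, w0, w1, w2, w3] <;> ring

variable {Ξ : Coord → ℝ} {κ : Fin 4 → Coord → ℝ}

/-! ### The evolution equations as components of the field equations -/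

theorem dir_eq_zero_of_const {F : Coord → ℝ} {c : ℝ} (hU : IsOpen U) (hx : x ∈ U)
    (hF : ∀ y ∈ U, F y = c) (a : Fin 4) : u.dir a F x = 0 :=
  Finset.sum_eq_zero fun μ _ => by rw [pd_eq_zero_of_const hU hF hx, mul_zero]

theorem IsConfiguration.d_self_left (hc : u.IsConfiguration U) (hx : x ∈ U) (a c g : Fin 4) :
    u.d a a c g x = 0 := by
  rw [d_eq_dlow, (hc.isWeylTensor hx).self_left, mul_zero]

theorem IsConfiguration.d_self_right (hc : u.IsConfiguration U) (hx : x ∈ U) (a b c : Fin 4) :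
    u.d a b c c x = 0 := by
  rw [d_eq_dlow, (hc.isWeylTensor hx).self_right, mul_zero]

theorem frame_evolution (hg : u.ConformalGaussianGauge U) (hE : u.ExtendedCFE Ξ κ U)
    (hU : IsOpen U) (hx : x ∈ U) (b ν : Fin 4) :
    pd 0 (u.e b ν) x = -∑ c, u.Γ b c 0 x * u.e c ν x := by
  have h := hE.torsion x hx 0 b ν
  rw [zeroTorsion, hg.dir_zero hx,
    dir_eq_zero_of_const hU hx (fun y hy => hg.time_leg y hy ν)] at h
  simp only [hg.weyl_propagated x hx, zero_sub, neg_mul, Finset.sum_neg_distrib] at h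
  linarith

theorem schouten_evolution (hg : u.ConformalGaussianGauge U) (hE : u.ExtendedCFE Ξ κ U)
    (hU : IsOpen U) (hx : x ∈ U) (d b : Fin 4) :
    pd 0 (u.L d b) x = -∑ c, u.Γ d c 0 x * u.L c b x + ∑ a, κ a x * u.d a b 0 d x := by
  have h := hE.schouten x hx 0 d b
  rw [zeroDelta, covL, covL, hg.dir_zero hx,
    dir_eq_zero_of_const hU hx (fun y hy => hg.schouten_zero y hy b)] at h
  simp only [hg.weyl_propagated x hx, hg.schouten_zero x hx, zero_mul, mul_zero,
    Finset.sum_const_zero] at h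
  linarith

theorem connection_evolution (hg : u.ConformalGaussianGauge U) (hE : u.ExtendedCFE Ξ κ U)
    (hU : IsOpen U) (hx : x ∈ U) (b c d : Fin 4) :
    pd 0 (u.Γ b c d) x = -∑ g, u.Γ g c d x * u.Γ b g 0 x + Ξ x * u.d c d 0 b x
      + kd d c * u.L b 0 x + kd 0 c * u.L b d x - eta d 0 * ∑ g, eta c g * u.L b g x := by
  have h := hE.curvature x hx c d 0 b
  have hS : ∑ g, tensorS d 0 c g * u.L b g x =
      kd d c * u.L b 0 x + kd 0 c * u.L b d x - eta d 0 * ∑ g, eta c g * u.L b g x := by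
    rw [← sum_kd_mul 0 fun g => u.L b g x, ← sum_kd_mul d fun g => u.L b g x, Finset.mul_sum,
      Finset.mul_sum, Finset.mul_sum, ← Finset.sum_add_distrib, ← Finset.sum_sub_distrib]
    exact Finset.sum_congr rfl fun g _ => by simp only [tensorS]; ring
  rw [geomCurv, algCurv, hg.dir_zero hx,
    dir_eq_zero_of_const hU hx (fun y hy => hg.weyl_propagated y hy d c)] at h
  simp only [hg.weyl_propagated x hx, hg.schouten_zero x hx, zero_mul, mul_zero, sub_zero,
    Finset.sum_const_zero, hS] at h
  linarith

theorem differentiableAt_Γ (hc : u.IsConfiguration U) (hU : IsOpen U) (hx : x ∈ U)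
    (a b c : Fin 4) : DifferentiableAt ℝ (u.Γ a b c) x :=
  ((hc.smooth_Γ a b c).differentiableOn one_ne_zero).differentiableAt (hU.mem_nhds hx)

/-- The evolution equation for `f_i` is the trace of the one for the connection coefficients. -/
theorem covector_evolution (hc : u.IsConfiguration U) (hg : u.ConformalGaussianGauge U)
    (hE : u.ExtendedCFE Ξ κ U) (hU : IsOpen U) (hx : x ∈ U) (i : Fin 3) :
    pd 0 (u.f i.succ) x =
      -∑ j : Fin 3, u.f j.succ x * u.Γ i.succ j.succ 0 x + u.L i.succ 0 x := by
  have hΓ := fun b => differentiableAt_Γ hc hU hx i.succ b b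
  have h1 : pd 0 (u.f i.succ) x = (1 / 4) * ∑ b, pd 0 (u.Γ i.succ b b) x := by
    rw [← pd_sum (fun b _ => hΓ b)]
    exact pd_const_mul (DifferentiableAt.fun_sum fun b _ => hΓ b) _ _
  have h2 : ∀ b, pd 0 (u.Γ i.succ b b) x = -∑ g, u.Γ g b b x * u.Γ i.succ g 0 x
      + u.L i.succ 0 x + (kd 0 b * u.L i.succ b x - kd 0 b * u.L i.succ b x) := fun b => by
    rw [connection_evolution hg hE hU hx, hc.d_self_left hx, sum_eta_mul]
    by_cases hb : b = 0
    · subst hb; simp [kd, eta]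
    · simp [kd, eta, hb, Ne.symm hb]
  have h3 : ∑ b, ∑ g, u.Γ g b b x * u.Γ i.succ g 0 x =
      4 * ∑ j : Fin 3, u.f j.succ x * u.Γ i.succ j.succ 0 x := by
    have h4 : ∀ g, ∑ b, u.Γ g b b x = 4 * u.f g x := fun g => by simp only [f]; ring
    rw [Finset.sum_comm]
    simp only [← Finset.sum_mul, h4]
    rw [Fin.sum_univ_succ, f_zero_of_gauge hg hx, Finset.mul_sum]
    simp only [mul_zero, zero_mul, zero_add]
    exact Finset.sum_congr rfl fun j _ => by ring
  simp only [h1, h2, sub_self, add_zero, Finset.sum_add_distrib, Finset.sum_neg_distrib, h3]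
  simp
  ring

theorem evolutionEquations_of_extendedCFE (hc : u.IsConfiguration U)
    (hg : u.ConformalGaussianGauge U) (hU : IsOpen U) (hE : u.ExtendedCFE Ξ κ U) :
    u.EvolutionEquations Ξ κ U where
  frame _ hx := frame_evolution hg hE hU hx
  schouten _ hx := schouten_evolution hg hE hU hx
  covector _ hx := covector_evolution hc hg hE hU hx
  connection _ hx := connection_evolution hg hE hU hx
  electric x hx i j := by
    rw [← sub_eq_zero, (evolution_eq_zeroLambda hc hg hU hx i j).1]
    simp [symm, hE.bianchi x hx]
  magnetic x hx i j := by
    rw [← sub_eq_zero, (evolution_eq_zeroLambda hc hg hU hx i j).2]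
    simp [symm, hE.bianchi x hx]

end Fields

/-! ### Symmetric trace-free tensors and linear operators on them -/

/-- The orthonormal basis of the symmetric trace-free spatial tensors in which `Fields.stf` takes
components. -/
def stfBasis : Fin 5 → Fin 3 → Fin 3 → ℝ :=
  ![![![√2 / 2, 0, 0], ![0, -√2 / 2, 0], ![0, 0, 0]],
    ![![-√(3 / 2) / 3, 0, 0], ![0, -√(3 / 2) / 3, 0], ![0, 0, 2 * √(3 / 2) / 3]],
    ![![0, √2 / 2, 0], ![√2 / 2, 0, 0], ![0, 0, 0]],
    ![![0, 0, √2 / 2], ![0, 0, 0], ![√2 / 2, 0, 0]],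
    ![![0, 0, 0], ![0, 0, √2 / 2], ![0, √2 / 2, 0]]]

/-- The tensor with given components in `stfBasis`. -/
def ofStf (v : Fin 5 → ℝ) (i j : Fin 3) : ℝ := ∑ I, v I * stfBasis I i j

theorem isSTF_stfBasis (I : Fin 5) : IsSTF (stfBasis I) where
  symm i j := by fin_cases I <;> fin_cases i <;> fin_cases j <;> simp [stfBasis]
  trace := by fin_cases I <;> simp [stfBasis, Fin.sum_univ_three] <;> ring

theorem isSTF_ofStf (v : Fin 5 → ℝ) : IsSTF (ofStf v) where
  symm i j := Finset.sum_congr rfl fun I _ => by rw [(isSTF_stfBasis I).symm]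
  trace := by
    simp only [ofStf]
    rw [Finset.sum_comm]
    exact Finset.sum_eq_zero fun I _ => by
      rw [← Finset.mul_sum, (isSTF_stfBasis I).trace, mul_zero]

theorem div_sqrt_two (a : ℝ) : a / √2 = a * (√2 / 2) := by
  have h : √(2 : ℝ) * √2 = 2 := Real.mul_self_sqrt (by norm_num)
  have h' : √(2 : ℝ) ≠ 0 := by positivity
  rw [div_eq_iff h']
  linear_combination (-a / 2) * h

theorem ofStf_stf {T : Fin 3 → Fin 3 → ℝ} (hT : IsSTF T) : ofStf (Fields.stf T) = T := by
  obtain ⟨h1, h2, h3, h4⟩ := hT.normal_form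
  have s2 : √(2 : ℝ) ^ 2 = 2 := Real.sq_sqrt (by norm_num)
  have s3 : √(3 / 2 : ℝ) ^ 2 = 3 / 2 := Real.sq_sqrt (by norm_num)
  ext i j
  simp only [ofStf, Fields.stf, div_sqrt_two, stfBasis]
  generalize √(2 : ℝ) = s at *
  generalize √(3 / 2 : ℝ) = r at *
  fin_cases i <;> fin_cases j <;>
    simp [Fin.sum_univ_five, h1, h2, h3, h4] <;> ring_nf <;> simp only [s2, s3] <;> ring

theorem stf_eq_sum {T : Fin 3 → Fin 3 → ℝ} (hT : IsSTF T) (I : Fin 5) :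
    Fields.stf T I = ∑ i, ∑ j, stfBasis I i j * T i j := by
  obtain ⟨h1, h2, h3, h4⟩ := hT.normal_form
  simp only [Fields.stf, div_sqrt_two, stfBasis]
  generalize √(2 : ℝ) = s at *
  fin_cases I <;> simp [Fin.sum_univ_three, h1, h2, h3, h4] <;> ring

theorem stf_ofStf (v : Fin 5 → ℝ) : Fields.stf (ofStf v) = v := by
  have s2 : √(2 : ℝ) ^ 2 = 2 := Real.sq_sqrt (by norm_num)
  have s3 : √(3 / 2 : ℝ) ^ 2 = 3 / 2 := Real.sq_sqrt (by norm_num)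
  ext I
  simp only [ofStf, Fields.stf, div_sqrt_two, stfBasis]
  generalize √(2 : ℝ) = s at *
  generalize √(3 / 2 : ℝ) = r at *
  fin_cases I <;>
    simp [Fin.sum_univ_five] <;> ring_nf <;> simp only [s2, s3] <;> ring

theorem IsSTF.eq_of_stf_eq {S T : Fin 3 → Fin 3 → ℝ} (hS : IsSTF S) (hT : IsSTF T)
    (h : Fields.stf S = Fields.stf T) : S = T := by
  rw [← ofStf_stf hS, h, ofStf_stf hT]

theorem sum_ofStf_mul (v : Fin 5 → ℝ) (S : Fin 3 → Fin 3 → ℝ) :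
    ∑ i, ∑ j, ofStf v i j * S i j = ∑ I, v I * ∑ i, ∑ j, stfBasis I i j * S i j := by
  simp only [ofStf, Finset.sum_mul, Finset.mul_sum]
  calc _ = ∑ i, ∑ I, ∑ j, v I * stfBasis I i j * S i j :=
        Finset.sum_congr rfl fun i _ => Finset.sum_comm
    _ = ∑ I, ∑ i, ∑ j, v I * stfBasis I i j * S i j := Finset.sum_comm
    _ = _ := by simp only [mul_assoc]

/-- The square of the norm of a symmetric trace-free tensor is that of its components. -/
theorem sum_ofStf_mul_ofStf (v : Fin 5 → ℝ) :
    ∑ i, ∑ j, ofStf v i j * ofStf v i j = ∑ I, v I * v I := by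
  rw [sum_ofStf_mul]
  exact Finset.sum_congr rfl fun I _ => by rw [← stf_eq_sum (isSTF_ofStf v), stf_ofStf]

/-- The matrix of a linear operator on spatial tensors, restricted to the symmetric trace-free ones,
in the basis `stfBasis`. -/
def stfMatrix (O : (Fin 3 → Fin 3 → ℝ) → Fin 3 → Fin 3 → ℝ) : Matrix (Fin 5) (Fin 5) ℝ :=
  Matrix.of fun I J => ∑ i, ∑ j, stfBasis I i j * O (stfBasis J) i j

theorem stfMatrix_mulVec {O : (Fin 3 → Fin 3 → ℝ) → Fin 3 → Fin 3 → ℝ} (hO : IsLinearMap ℝ O)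
    (v : Fin 5 → ℝ) (I : Fin 5) :
    (stfMatrix O *ᵥ v) I = ∑ i, ∑ j, stfBasis I i j * O (ofStf v) i j := by
  have h : O (ofStf v) = ∑ J, v J • O (stfBasis J) := by
    have h1 : ofStf v = ∑ J, v J • stfBasis J := by
      ext i j
      simp [ofStf, Finset.sum_apply]
    rw [h1]
    have h2 := map_sum (hO.mk' O) (fun J => v J • stfBasis J) Finset.univ
    simp only [map_smul, IsLinearMap.mk'_apply] at h2
    exact h2
  simp only [h, Finset.sum_apply, Pi.smul_apply, smul_eq_mul, Finset.mul_sum]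
  calc _ = ∑ J, ∑ i, ∑ j, stfBasis I i j * (v J * O (stfBasis J) i j) := by
        simp only [Matrix.mulVec, dotProduct, stfMatrix, Matrix.of_apply, Finset.sum_mul]
        exact Finset.sum_congr rfl fun J _ => Finset.sum_congr rfl fun i _ =>
          Finset.sum_congr rfl fun j _ => by ring
    _ = ∑ i, ∑ J, ∑ j, stfBasis I i j * (v J * O (stfBasis J) i j) := Finset.sum_comm
    _ = _ := Finset.sum_congr rfl fun i _ => Finset.sum_comm

theorem stfMatrix_mulVec_stf {O : (Fin 3 → Fin 3 → ℝ) → Fin 3 → Fin 3 → ℝ} (hO : IsLinearMap ℝ O)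
    {T : Fin 3 → Fin 3 → ℝ} (hT : IsSTF T) (hOT : IsSTF (O T)) :
    stfMatrix O *ᵥ Fields.stf T = Fields.stf (O T) := by
  ext I
  rw [stfMatrix_mulVec hO, ofStf_stf hT, stf_eq_sum hOT]

/-! ### The operators of the Bianchi system -/

/-- The principal symbol `T ↦ ε^{kl}{}_{(j} ξ_{|l|} T_{i)k}` of the curl. -/
def crossOp (ξ : Fin 3 → ℝ) (T : Fin 3 → Fin 3 → ℝ) (i j : Fin 3) : ℝ :=
  Fields.symm (fun i j => ∑ k, ∑ l, ξ l * eps3 k l j * T i k) i j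

/-- The terms of lowest order in the curl, `γ l m k` being the connection coefficient
`γ_l{}^m{}_k`. -/
def connOp (γ : Fin 3 → Fin 3 → Fin 3 → ℝ) (T : Fin 3 → Fin 3 → ℝ) (i j : Fin 3) : ℝ :=
  Fields.symm (fun i j => ∑ k, ∑ l, eps3 k l j *
    (∑ m, γ l m i * T m k + ∑ m, γ l m k * T i m)) i j

/-- The operator in the terms `Fields.chiTerms` of the evolution equations. -/
def chiOp (χ : Fin 3 → Fin 3 → ℝ) (T : Fin 3 → Fin 3 → ℝ) (i j : Fin 3) : ℝ :=
  -2 * (∑ k, χ k k) * T i j + 2 * Fields.symm (fun i j => ∑ k, χ k i * T j k) i j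
    + Fields.symm (fun i j => ∑ k, χ i k * T j k) i j - kd i j * ∑ k, ∑ l, χ k l * T k l

theorem isLinearMap_crossOp (ξ : Fin 3 → ℝ) : IsLinearMap ℝ (crossOp ξ) where
  map_add S T := by
    ext i j
    simp only [crossOp, Fields.symm, Pi.add_apply, mul_add, Finset.sum_add_distrib]
    ring
  map_smul c T := by
    ext i j
    simp only [crossOp, Fields.symm, Pi.smul_apply, smul_eq_mul, mul_left_comm _ c,
      ← Finset.mul_sum]
    ring

theorem isLinearMap_connOp (γ : Fin 3 → Fin 3 → Fin 3 → ℝ) : IsLinearMap ℝ (connOp γ) where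
  map_add S T := by
    ext i j
    simp only [connOp, Fields.symm, Pi.add_apply, mul_add, Finset.sum_add_distrib]
    ring
  map_smul c T := by
    ext i j
    simp only [connOp, Fields.symm, Pi.smul_apply, smul_eq_mul, mul_left_comm _ c,
      ← Finset.mul_sum, ← mul_add]

theorem isLinearMap_chiOp (χ : Fin 3 → Fin 3 → ℝ) : IsLinearMap ℝ (chiOp χ) where
  map_add S T := by
    ext i j
    simp only [chiOp, Fields.symm, Pi.add_apply, mul_add, Finset.sum_add_distrib]
    ring
  map_smul c T := by
    ext i j
    simp only [chiOp, Fields.symm, Pi.smul_apply, smul_eq_mul, mul_left_comm _ c,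
      ← Finset.mul_sum, ← mul_add]
    ring

theorem symm_comm (M : Fin 3 → Fin 3 → ℝ) (i j : Fin 3) :
    Fields.symm M i j = Fields.symm M j i := by
  simp only [Fields.symm, add_comm]

theorem isSTF_crossOp (ξ : Fin 3 → ℝ) {T : Fin 3 → Fin 3 → ℝ} (hT : IsSTF T) :
    IsSTF (crossOp ξ T) where
  symm i j := symm_comm _ i j
  trace := by
    obtain ⟨h1, h2, h3, h4⟩ := hT.normal_form
    simp [crossOp, Fields.symm, Fin.sum_univ_three, eps3_eq, kd, h1, h2, h3]
    ring

theorem isSTF_connOp (γ : Fin 3 → Fin 3 → Fin 3 → ℝ) {T : Fin 3 → Fin 3 → ℝ} (hT : IsSTF T) :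
    IsSTF (connOp γ T) where
  symm i j := symm_comm _ i j
  trace := by
    obtain ⟨h1, h2, h3, h4⟩ := hT.normal_form
    simp [connOp, Fields.symm, Fin.sum_univ_three, eps3_eq, kd, h1, h2, h3]
    ring

theorem isSTF_chiOp (χ : Fin 3 → Fin 3 → ℝ) {T : Fin 3 → Fin 3 → ℝ} (hT : IsSTF T) :
    IsSTF (chiOp χ T) where
  symm i j := by
    simp only [chiOp, hT.symm i j, symm_comm _ i j, kd, eq_comm]
  trace := by
    obtain ⟨h1, h2, h3, h4⟩ := hT.normal_form
    simp [chiOp, Fields.symm, Fin.sum_univ_three, kd, h1, h2, h3, h4]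
    ring

theorem IsSTF.add {S T : Fin 3 → Fin 3 → ℝ} (hS : IsSTF S) (hT : IsSTF T) : IsSTF (S + T) where
  symm i j := by simp [hS.symm i j, hT.symm i j]
  trace := by simp [Finset.sum_add_distrib, hS.trace, hT.trace]

theorem IsSTF.sub {S T : Fin 3 → Fin 3 → ℝ} (hS : IsSTF S) (hT : IsSTF T) : IsSTF (S - T) where
  symm i j := by simp [hS.symm i j, hT.symm i j]
  trace := by simp [hS.trace, hT.trace]

theorem IsSTF.sum {ι : Type*} {s : Finset ι} {T : ι → Fin 3 → Fin 3 → ℝ}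
    (hT : ∀ i ∈ s, IsSTF (T i)) : IsSTF (∑ i ∈ s, T i) where
  symm i j := by
    simp only [Finset.sum_apply]
    exact Finset.sum_congr rfl fun k hk => (hT k hk).symm i j
  trace := by
    simp only [Finset.sum_apply]
    rw [Finset.sum_comm]
    exact Finset.sum_eq_zero fun k hk => (hT k hk).trace

theorem IsSTF.smul {T : Fin 3 → Fin 3 → ℝ} (c : ℝ) (hT : IsSTF T) : IsSTF (c • T) where
  symm i j := by simp [hT.symm i j]
  trace := by simp [← Finset.mul_sum, hT.trace]

/-! ### The principal part -/

/-- On symmetric tensors the symmetrisation in `crossOp` may be dropped from the pairing. -/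
theorem sum_mul_crossOp (ξ : Fin 3 → ℝ) {S T : Fin 3 → Fin 3 → ℝ} (hS : IsSTF S) :
    ∑ i, ∑ j, S i j * crossOp ξ T i j = ∑ i, ∑ j, S i j * ∑ k, ∑ l, ξ l * eps3 k l j * T i k := by
  have h : ∑ i, ∑ j, S i j * (∑ k, ∑ l, ξ l * eps3 k l i * T j k) =
      ∑ i, ∑ j, S i j * ∑ k, ∑ l, ξ l * eps3 k l j * T i k := by
    rw [Finset.sum_comm]
    exact Finset.sum_congr rfl fun i _ => Finset.sum_congr rfl fun j _ => by rw [hS.symm]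
  simp only [crossOp, Fields.symm, mul_add, Finset.sum_add_distrib, mul_left_comm _ (1 / 2 : ℝ),
    ← Finset.mul_sum] at h ⊢
  rw [h]; ring

/-- The matrix of the symbol of the curl. -/
def symbolMatrix (ξ : Fin 3 → ℝ) : Matrix (Fin 5) (Fin 5) ℝ := stfMatrix (crossOp ξ)

theorem symbolMatrix_transpose (ξ : Fin 3 → ℝ) : (symbolMatrix ξ)ᵀ = -symbolMatrix ξ := by
  ext I J
  simp only [symbolMatrix, stfMatrix, Matrix.transpose_apply, Matrix.of_apply, Matrix.neg_apply]
  rw [sum_mul_crossOp ξ (isSTF_stfBasis J), sum_mul_crossOp ξ (isSTF_stfBasis I),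
    ← Finset.sum_neg_distrib]
  refine Finset.sum_congr rfl fun i _ => ?_
  simp only [Finset.mul_sum, ← Finset.sum_neg_distrib]
  rw [Finset.sum_comm]
  refine Finset.sum_congr rfl fun j _ => Finset.sum_congr rfl fun k _ =>
    Finset.sum_congr rfl fun l _ => ?_
  have h : eps3 j l k = -eps3 k l j := by simp only [eps3_eq]; ring
  rw [h]; ring

/-- The block matrix acting by a matrix on the electric and the magnetic part and by another,
with opposite signs, between them. -/
def dualityBlocks (X Y : Matrix (Fin 5) (Fin 5) ℝ) : Matrix PhiIdx PhiIdx ℝ :=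
  Matrix.fromBlocks X Y (-Y) X

/-- The matrices `A^μ`, `e` being the independent frame coefficients. -/
def principal (μ : Fin 4) (e : FrameIdx → ℝ) : Matrix PhiIdx PhiIdx ℝ :=
  dualityBlocks 0 (symbolMatrix fun l => e (l, μ))

theorem isHermitian_principal (μ : Fin 4) (e : FrameIdx → ℝ) : (principal μ e).IsHermitian :=
  Matrix.IsHermitian.fromBlocks Matrix.isHermitian_zero
    (by rw [Matrix.conjTranspose_eq_transpose_of_trivial, symbolMatrix_transpose])
    Matrix.isHermitian_zero

theorem dot_symbolMatrix_mulVec (ξ : Fin 3 → ℝ) (v w : Fin 5 → ℝ) :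
    v ⬝ᵥ symbolMatrix ξ *ᵥ w =
      ∑ i, ∑ j, ofStf v i j * ∑ k, ∑ l, ξ l * eps3 k l j * ofStf w i k := by
  rw [← sum_mul_crossOp ξ (isSTF_ofStf v), sum_ofStf_mul]
  simp only [dotProduct, symbolMatrix, stfMatrix_mulVec (isLinearMap_crossOp ξ)]

/-- The symbol of the curl has norm at most `|ξ|`: row by row it is the vector product with `ξ`. -/
theorem norm_sq_add_cross_le (ξ : Fin 3 → ℝ) (S T : Fin 3 → Fin 3 → ℝ) (i : Fin 3) :
    (1 - ∑ l, ξ l ^ 2) * ∑ j, T i j * T i j ≤ ∑ j, S i j * S i j + ∑ j, T i j * T i j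
      + 2 * ∑ j, S i j * ∑ k, ∑ l, ξ l * eps3 k l j * T i k := by
  simp [Fin.sum_univ_three, eps3_eq, kd]
  -- The difference of the two sides is `|S_i + T_i × ξ|² + (ξ · T_i)²`.
  linarith [sq_nonneg (S i 0 + (ξ 2 * T i 1 - ξ 1 * T i 2)),
    sq_nonneg (S i 1 + (ξ 0 * T i 2 - ξ 2 * T i 0)),
    sq_nonneg (S i 2 + (ξ 1 * T i 0 - ξ 0 * T i 1)),
    sq_nonneg (ξ 0 * T i 0 + ξ 1 * T i 1 + ξ 2 * T i 2)]

theorem dot_symbolMatrix_comm (ξ : Fin 3 → ℝ) (v w : Fin 5 → ℝ) :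
    v ⬝ᵥ symbolMatrix ξ *ᵥ w = -(w ⬝ᵥ symbolMatrix ξ *ᵥ v) := by
  rw [Matrix.dotProduct_mulVec, ← Matrix.mulVec_transpose, symbolMatrix_transpose,
    Matrix.neg_mulVec, neg_dotProduct, dotProduct_comm]

theorem dot_principal_mulVec (μ : Fin 4) (e : FrameIdx → ℝ) (v w : Fin 5 → ℝ) :
    Sum.elim v w ⬝ᵥ principal μ e *ᵥ Sum.elim v w =
      2 * (v ⬝ᵥ symbolMatrix (fun l => e (l, μ)) *ᵥ w) := by
  rw [principal, dualityBlocks, Matrix.fromBlocks_mulVec]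
  simp [Matrix.neg_mulVec, dot_symbolMatrix_comm _ w v]
  ring

/-- The bound on the symbol, summed over the rows and averaged over the two ways of completing the
square, makes the quadratic form of `1 + A⁰` definite when `d τ` is timelike. -/
theorem posDef_one_add_principal (e : FrameIdx → ℝ) (he : ∑ i : Fin 3, e (i, 0) ^ 2 < 1) :
    (1 + principal 0 e).PosDef := by
  refine Matrix.PosDef.of_dotProduct_mulVec_pos
    (Matrix.isHermitian_one.add (isHermitian_principal 0 e)) fun x hx => ?_
  obtain ⟨v, w, rfl⟩ : ∃ v w, x = Sum.elim v w := ⟨_, _, (Sum.elim_comp_inl_inr x).symm⟩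
  set ξ : Fin 3 → ℝ := fun l => e (l, 0) with hξ
  set c := 1 - ∑ l, ξ l ^ 2 with hc
  have hc0 : 0 < c := by rw [hc]; linarith
  have key : ∀ v w : Fin 5 → ℝ, c * (w ⬝ᵥ w) ≤
      v ⬝ᵥ v + w ⬝ᵥ w + 2 * (v ⬝ᵥ symbolMatrix ξ *ᵥ w) := fun v w => by
    have h := Finset.sum_le_sum fun i (_ : i ∈ Finset.univ) =>
      norm_sq_add_cross_le ξ (ofStf v) (ofStf w) i
    rw [← Finset.mul_sum, Finset.sum_add_distrib, Finset.sum_add_distrib, ← Finset.mul_sum,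
      ← dot_symbolMatrix_mulVec, sum_ofStf_mul_ofStf, sum_ofStf_mul_ofStf] at h
    exact h
  have h1 := key v w
  have h2 := key (-w) v
  simp only [neg_dotProduct, dotProduct_neg, neg_neg, dot_symbolMatrix_comm ξ w v] at h2
  have hpos : 0 < v ⬝ᵥ v + w ⬝ᵥ w := by
    have h4 : 0 < Sum.elim v w ⬝ᵥ Sum.elim v w :=
      lt_of_le_of_ne (Finset.sum_nonneg fun i _ => mul_self_nonneg _)
        fun h => hx (dotProduct_self_eq_zero.1 h.symm)
    simpa [dotProduct, Fintype.sum_sum_type] using h4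
  rw [star_trivial, Matrix.add_mulVec, dotProduct_add, Matrix.one_mulVec, dot_principal_mulVec]
  -- `h1 + h2` is the assertion that twice the quadratic form is at least `c * |x|²`.
  have h5 : Sum.elim v w ⬝ᵥ Sum.elim v w = v ⬝ᵥ v + w ⬝ᵥ w := by
    simp [dotProduct, Fintype.sum_sum_type]
  rw [h5]
  nlinarith [mul_pos hc0 hpos]

/-! ### The Bianchi system in independent components -/

/-- Taking the independent components, as a linear map. -/
def stfLin : (Fin 3 → Fin 3 → ℝ) →ₗ[ℝ] (Fin 5 → ℝ) where
  toFun := Fields.stf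
  map_add' S T := by
    ext I
    fin_cases I <;> simp [Fields.stf] <;> ring
  map_smul' c T := by
    ext I
    fin_cases I <;> simp [Fields.stf] <;> ring

/-- The spatial Levi-Civita coefficients `Γ_l{}^m{}_k` in terms of the independent connection
coefficients. -/
def spatialConn (Γ : ConnIdx → ℝ) (l m k : Fin 3) : ℝ :=
  (∑ n, eps3 m k n * Γ (.inr (.inl (l, n)))) - kd l m * Γ (.inr (.inr k))
    + kd l k * Γ (.inr (.inr m))

/-- The matrix `B`. The acceleration is `-f`, whence the sign of its term. -/
def lowerOrder (Γ : ConnIdx → ℝ) : Matrix PhiIdx PhiIdx ℝ :=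
  dualityBlocks (stfMatrix (chiOp fun i j => Γ (.inl (i, j))))
    (stfMatrix (connOp (spatialConn Γ))
      + (2 : ℝ) • stfMatrix (crossOp fun i => Γ (.inr (.inr i))))

theorem contDiff_stfMatrix_crossOp {E : Type*} [NormedAddCommGroup E] [NormedSpace ℝ E]
    {ξ : E → Fin 3 → ℝ} (hξ : ∀ i, ContDiff ℝ ∞ fun e => ξ e i) (I J : Fin 5) :
    ContDiff ℝ ∞ fun e => stfMatrix (crossOp (ξ e)) I J := by
  simp only [stfMatrix, Matrix.of_apply, crossOp, Fields.symm]
  fun_prop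

theorem contDiff_dualityBlocks {E : Type*} [NormedAddCommGroup E] [NormedSpace ℝ E]
    {X Y : E → Matrix (Fin 5) (Fin 5) ℝ} (hX : ∀ I J, ContDiff ℝ ∞ fun e => X e I J)
    (hY : ∀ I J, ContDiff ℝ ∞ fun e => Y e I J) (I J : PhiIdx) :
    ContDiff ℝ ∞ fun e => dualityBlocks (X e) (Y e) I J := by
  rcases I with I | I <;> rcases J with J | J
  · exact hX I J
  · exact hY I J
  · exact (hY I J).neg
  · exact hX I J

theorem contDiff_principal (μ : Fin 4) (I J : PhiIdx) :
    ContDiff ℝ ∞ fun e => principal μ e I J :=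
  contDiff_dualityBlocks (fun _ _ => contDiff_const)
    (contDiff_stfMatrix_crossOp fun i => by fun_prop) I J

theorem contDiff_lowerOrder (I J : PhiIdx) : ContDiff ℝ ∞ fun Γ => lowerOrder Γ I J := by
  refine contDiff_dualityBlocks (fun I J => ?_) (fun I J => ?_) I J
  · simp only [stfMatrix, Matrix.of_apply, chiOp, Fields.symm]
    fun_prop
  · refine ContDiff.add ?_ (contDiff_const.mul (contDiff_stfMatrix_crossOp (fun i => ?_) I J))
    · simp only [stfMatrix, Matrix.of_apply, connOp, Fields.symm, spatialConn]
      fun_prop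
    · fun_prop

theorem dualityBlocks_mulVec (X Y : Matrix (Fin 5) (Fin 5) ℝ) (v w : Fin 5 → ℝ) :
    dualityBlocks X Y *ᵥ Sum.elim v w = Sum.elim (X *ᵥ v + Y *ᵥ w) (X *ᵥ w - Y *ᵥ v) := by
  rw [dualityBlocks, Matrix.fromBlocks_mulVec]
  simp only [Sum.elim_comp_inl, Sum.elim_comp_inr, Matrix.neg_mulVec]
  congr 1
  abel

theorem principal_mulVec_stf (μ : Fin 4) (e : FrameIdx → ℝ) {S T : Fin 3 → Fin 3 → ℝ}
    (hS : IsSTF S) (hT : IsSTF T) :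
    principal μ e *ᵥ Sum.elim (Fields.stf S) (Fields.stf T) =
      Sum.elim (stfLin (crossOp (fun l => e (l, μ)) T))
        (-stfLin (crossOp (fun l => e (l, μ)) S)) := by
  have hl := isLinearMap_crossOp fun l => e (l, μ)
  rw [principal, dualityBlocks_mulVec, symbolMatrix,
    stfMatrix_mulVec_stf hl hS (isSTF_crossOp _ hS),
    stfMatrix_mulVec_stf hl hT (isSTF_crossOp _ hT), Matrix.zero_mulVec, Matrix.zero_mulVec,
    zero_add, zero_sub]
  rfl

theorem lowerOrder_mulVec_stf (Γ : ConnIdx → ℝ) {S T : Fin 3 → Fin 3 → ℝ}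
    (hS : IsSTF S) (hT : IsSTF T) :
    lowerOrder Γ *ᵥ Sum.elim (Fields.stf S) (Fields.stf T) =
      Sum.elim
        (stfLin (chiOp (fun i j => Γ (.inl (i, j))) S + (connOp (spatialConn Γ) T
          + (2 : ℝ) • crossOp (fun i => Γ (.inr (.inr i))) T)))
        (stfLin (chiOp (fun i j => Γ (.inl (i, j))) T - (connOp (spatialConn Γ) S
          + (2 : ℝ) • crossOp (fun i => Γ (.inr (.inr i))) S))) := by
  rw [lowerOrder, dualityBlocks_mulVec]
  simp only [Matrix.add_mulVec, Matrix.smul_mulVec, map_add, map_sub, map_smul,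
    stfMatrix_mulVec_stf (isLinearMap_chiOp _) hS (isSTF_chiOp _ hS),
    stfMatrix_mulVec_stf (isLinearMap_chiOp _) hT (isSTF_chiOp _ hT),
    stfMatrix_mulVec_stf (isLinearMap_connOp _) hS (isSTF_connOp _ hS),
    stfMatrix_mulVec_stf (isLinearMap_connOp _) hT (isSTF_connOp _ hT),
    stfMatrix_mulVec_stf (isLinearMap_crossOp _) hS (isSTF_crossOp _ hS),
    stfMatrix_mulVec_stf (isLinearMap_crossOp _) hT (isSTF_crossOp _ hT)]
  rfl

namespace Fields

variable {u : Fields} {U : Set Coord} {x : Coord} {Ξ : Coord → ℝ} {κ : Fin 4 → Coord → ℝ}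

theorem IsConfiguration.lc_eq_spatialConn (hc : u.IsConfiguration U) (hx : x ∈ U)
    (l m k : Fin 3) : u.lc l.succ m.succ k.succ x = spatialConn (u.connVec x) l m k := by
  rw [lc_succ_succ_succ, hc.Γ_succ_succ_eq_sum hx, spatialConn, kd_comm k m]
  simp only [connVec, Sum.elim_inl, Sum.elim_inr]
  ring

theorem IsConfiguration.curl_eq (hc : u.IsConfiguration U) (hx : x ∈ U)
    (T : Fin 3 → Fin 3 → Coord → ℝ) : (fun i j => u.curl T i j x) =
      ∑ μ, crossOp (fun l => u.frameVec x (l, μ)) (fun i j => pd μ (T i j) x)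
        - connOp (spatialConn (u.connVec x)) fun i j => T i j x := by
  ext i j
  simp only [curl, covD, symm, dir, crossOp, connOp, Pi.sub_apply, Finset.sum_apply,
    hc.lc_eq_spatialConn hx, frameVec]
  have h : ∀ i j, ∑ k, ∑ l, eps3 k l j * ((∑ μ, u.e l.succ μ x * pd μ (T i k) x)
      - ∑ m, spatialConn (u.connVec x) l m i * T m k x
      - ∑ m, spatialConn (u.connVec x) l m k * T i m x) =
      ∑ μ, ∑ k, ∑ l, u.e l.succ μ x * eps3 k l j * pd μ (T i k) x
        - ∑ k, ∑ l, eps3 k l j * (∑ m, spatialConn (u.connVec x) l m i * T m k x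
          + ∑ m, spatialConn (u.connVec x) l m k * T i m x) := fun i j => by
    have comm : ∑ μ, ∑ k, ∑ l, u.e l.succ μ x * eps3 k l j * pd μ (T i k) x =
        ∑ k, ∑ l, eps3 k l j * ∑ μ, u.e l.succ μ x * pd μ (T i k) x := by
      rw [Finset.sum_comm]
      refine Finset.sum_congr rfl fun k _ => ?_
      rw [Finset.sum_comm]
      refine Finset.sum_congr rfl fun l _ => ?_
      rw [Finset.mul_sum]
      exact Finset.sum_congr rfl fun μ _ => by ring
    rw [comm, ← Finset.sum_sub_distrib]
    refine Finset.sum_congr rfl fun k _ => ?_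
    rw [← Finset.sum_sub_distrib]
    exact Finset.sum_congr rfl fun l _ => by ring
  rw [h, h, ← Finset.mul_sum, Finset.sum_add_distrib]
  ring

theorem accCross_eq (hg : u.ConformalGaussianGauge U) (hx : x ∈ U)
    (T : Fin 3 → Fin 3 → Coord → ℝ) : (fun i j => u.accCross T i j x) =
      -crossOp (fun i => u.connVec x (.inr (.inr i))) fun i j => T i j x := by
  ext i j
  simp only [accCross, crossOp, symm, acc_eq hg hx, connVec, Sum.elim_inr, Pi.neg_apply, neg_mul,
    Finset.sum_neg_distrib]
  ring

theorem chiTerms_eq (hg : u.ConformalGaussianGauge U) (hx : x ∈ U)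
    (T : Fin 3 → Fin 3 → Coord → ℝ) : (fun i j => u.chiTerms T i j x) =
      chiOp (fun i j => u.connVec x (.inl (i, j))) fun i j => T i j x := by
  ext i j
  simp only [chiTerms, chiOp, trchi, chi_eq hg hx, connVec, Sum.elim_inl]

theorem pd_stf {T : Fin 3 → Fin 3 → Coord → ℝ} (hU : IsOpen U) (hx : x ∈ U)
    (hd : ∀ i j, DifferentiableAt ℝ (T i j) x) (hT : ∀ y ∈ U, IsSTF fun i j => T i j y)
    (μ : Fin 4) (I : Fin 5) :
    pd μ (fun y => stf (fun i j => T i j y) I) x = stf (fun i j => pd μ (T i j) x) I := by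
  rw [stf_eq_sum (isSTF_pd hU hx hd hT μ),
    pd_congr_of_isOpen hU (fun y hy => stf_eq_sum (hT y hy) I) hx, pd_sum fun i _ => by fun_prop]
  refine Finset.sum_congr rfl fun i _ => ?_
  rw [pd_sum fun j _ => by fun_prop]
  exact Finset.sum_congr rfl fun j _ => pd_const_mul (hd i j) _ _

theorem IsConfiguration.pd_phi (hc : u.IsConfiguration U) (hU : IsOpen U) (hx : x ∈ U)
    (μ : Fin 4) : (fun I => pd μ (fun y => u.phi y I) x) =
      Sum.elim (stf fun i j => pd μ (u.el i j) x) (stf fun i j => pd μ (u.mag i j) x) := by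
  ext I
  rcases I with I | I
  · exact pd_stf hU hx (hc.differentiableAt_el hU hx) (fun _ hy => hc.isSTF_el hy) μ I
  · exact pd_stf hU hx (hc.differentiableAt_mag hU hx) (fun _ hy => hc.isSTF_mag hy) μ I

/-- The Bianchi system in independent components. Both sides of each tensor equation are symmetric
and trace-free, so that nothing is lost by passing to components. -/
theorem pde_iff (hc : u.IsConfiguration U) (hg : u.ConformalGaussianGauge U) (hU : IsOpen U)
    (hx : x ∈ U) :
    ((1 + principal 0 (u.frameVec x)) *ᵥ (fun I => pd 0 (fun y => u.phi y I) x)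
        + ∑ α : Fin 3, principal α.succ (u.frameVec x) *ᵥ
          (fun I => pd α.succ (fun y => u.phi y I) x)
      = lowerOrder (u.connVec x) *ᵥ u.phi x) ↔
    (∀ i j, pd 0 (u.el i j) x + u.curl u.mag i j x
      = -2 * u.accCross u.mag i j x + u.chiTerms u.el i j x) ∧
    (∀ i j, pd 0 (u.mag i j) x - u.curl u.el i j x
      = 2 * u.accCross u.el i j x + u.chiTerms u.mag i j x) := by
  have hE := hc.isSTF_el hx
  have hB := hc.isSTF_mag hx
  have dE := hc.isSTF_pd_el hU hx
  have dB := hc.isSTF_pd_mag hU hx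
  have h1 : (1 + principal 0 (u.frameVec x)) *ᵥ (fun I => pd 0 (fun y => u.phi y I) x)
        + ∑ α : Fin 3, principal α.succ (u.frameVec x) *ᵥ
          (fun I => pd α.succ (fun y => u.phi y I) x) =
      Sum.elim (stfLin ((fun i j => pd 0 (u.el i j) x)
          + ∑ μ, crossOp (fun l => u.frameVec x (l, μ)) fun i j => pd μ (u.mag i j) x))
        (stfLin ((fun i j => pd 0 (u.mag i j) x)
          - ∑ μ, crossOp (fun l => u.frameVec x (l, μ)) fun i j => pd μ (u.el i j) x)) := by
    rw [Matrix.add_mulVec, Matrix.one_mulVec, add_assoc,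
      ← Fin.sum_univ_succ fun μ => principal μ (u.frameVec x) *ᵥ
        fun I => pd μ (fun y => u.phi y I) x]
    simp only [hc.pd_phi hU hx, principal_mulVec_stf _ _ (dE _) (dB _), map_add, map_sub, map_sum]
    ext I
    rcases I with I | I
    · simp [Finset.sum_apply]; rfl
    · simp [Finset.sum_apply, sub_eq_add_neg]; rfl
  rw [h1, phi, lowerOrder_mulVec_stf _ hE hB]
  have h2 : ∀ {S T : Fin 3 → Fin 3 → ℝ}, IsSTF S → IsSTF T → (stfLin S = stfLin T ↔ S = T) :=
    fun hS hT => ⟨fun h => hS.eq_of_stf_eq hT h, fun h => by rw [h]⟩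
  rw [Sum.elim_eq_iff, h2, h2]
  · have e1 := congr_fun₂ (hc.curl_eq hx u.mag)
    have e2 := congr_fun₂ (hc.curl_eq hx u.el)
    have e3 := congr_fun₂ (accCross_eq hg hx u.mag)
    have e4 := congr_fun₂ (accCross_eq hg hx u.el)
    have e5 := congr_fun₂ (chiTerms_eq hg hx u.el)
    have e6 := congr_fun₂ (chiTerms_eq hg hx u.mag)
    simp only [e1, e2, e3, e4, e5, e6, funext_iff, Pi.add_apply, Pi.sub_apply, Pi.smul_apply,
      Pi.neg_apply, smul_eq_mul]
    refine and_congr (forall₂_congr fun i j => ?_) (forall₂_congr fun i j => ?_) <;>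
    constructor <;> intro h <;> linarith
  · exact (dB 0).sub (.sum fun μ _ => isSTF_crossOp _ (dE μ))
  · exact (isSTF_chiOp _ hB).sub ((isSTF_connOp _ hE).add (.smul 2 (isSTF_crossOp _ hE)))
  · exact (dE 0).add (.sum fun μ _ => isSTF_crossOp _ (dB μ))
  · exact (isSTF_chiOp _ hE).add ((isSTF_connOp _ hB).add (.smul 2 (isSTF_crossOp _ hB)))

end Fields

/-! ### The transport equations in independent components -/

/-- The matrix `K`: since `Γ̂_i{}^0{}_0 = f_i` and `e_0 = ∂_τ`, the equation for `e_i{}^0` has the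
term `-f_i`, while those for `Γ̂_i{}^j{}_0` and `f_i` have the terms `L̂_{ij}` and `L̂_{i0}`. -/
def linearPart : Matrix UpsIdx UpsIdx ℝ
  | .inl (i, ν), .inr (.inl (.inr (.inr j))) => -(kd 0 ν * kd i j)
  | .inr (.inl (.inl (i, j))), .inr (.inr (k, a)) => kd i k * kd j.succ a
  | .inr (.inl (.inr (.inr i))), .inr (.inr (k, a)) => kd i k * kd 0 a
  | _, _ => 0

/-- The matrix `Q(Γ)`: every unknown carries one free frame index `i`, on which `-Γ̂_i{}^j{}_0`
acts. -/
def quadraticPart (Γ : ConnIdx → ℝ) : Matrix UpsIdx UpsIdx ℝ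
  | .inl (i, ν), .inl (j, μ) => -Γ (.inl (i, j)) * kd ν μ
  | .inr (.inl (.inl (i, k))), .inr (.inl (.inl (j, l))) => -Γ (.inl (i, j)) * kd k l
  | .inr (.inl (.inr (.inl (i, k)))), .inr (.inl (.inr (.inl (j, l)))) =>
      -Γ (.inl (i, j)) * kd k l
  | .inr (.inl (.inr (.inr i))), .inr (.inl (.inr (.inr j))) => -Γ (.inl (i, j))
  | .inr (.inr (i, a)), .inr (.inr (j, b)) => -Γ (.inl (i, j)) * kd a b
  | _, _ => 0

/-- The electric part of the Weyl tensor whose only nonzero independent component is a given one,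
with value `1`. -/
def elBasis : PhiIdx → Fin 3 → Fin 3 → ℝ := Sum.elim stfBasis 0

/-- The magnetic part of the same tensor. -/
def magBasis : PhiIdx → Fin 3 → Fin 3 → ℝ := Sum.elim 0 stfBasis

/-- The matrix `L(x)`, which depends on the point through the conformal gauge fields only. -/
def sourcePart (Ξ : Coord → ℝ) (κ : Fin 4 → Coord → ℝ) (x : Coord) : Matrix UpsIdx PhiIdx ℝ
  | .inr (.inl (.inl (i, j))), J => -(Ξ x * elBasis J j i)
  | .inr (.inl (.inr (.inl (i, k)))), J => -(Ξ x * magBasis J k i)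
  | .inr (.inr (i, a)), J =>
      ∑ c, κ c x * (eta c c * weylOf (elBasis J) (magBasis J) c a 0 i.succ)
  | _, _ => 0

theorem contDiff_quadraticPart (I J : UpsIdx) : ContDiff ℝ ∞ fun Γ => quadraticPart Γ I J := by
  rcases I with ⟨i, ν⟩ | (⟨i, j⟩ | ⟨i, j⟩ | i) | ⟨i, a⟩ <;>
    rcases J with ⟨k, μ⟩ | (⟨k, l⟩ | ⟨k, l⟩ | k) | ⟨k, b⟩ <;>
    simp only [quadraticPart] <;> fun_prop

theorem contDiffOn_sourcePart {Ξ : Coord → ℝ} {κ : Fin 4 → Coord → ℝ} {U : Set Coord}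
    (hΞ : ContDiffOn ℝ ∞ Ξ U) (hκ : ∀ a, ContDiffOn ℝ ∞ (κ a) U) (I : UpsIdx) (J : PhiIdx) :
    ContDiffOn ℝ ∞ (fun x => sourcePart Ξ κ x I J) U := by
  rcases I with ⟨i, ν⟩ | (⟨i, j⟩ | ⟨i, j⟩ | i) | ⟨i, a⟩ <;> simp only [sourcePart] <;> fun_prop

theorem sum_weylOf_mul {ι : Type*} (s : Finset ι) (r : ι → ℝ) (E B : ι → Fin 3 → Fin 3 → ℝ)
    (a b c g : Fin 4) : ∑ J ∈ s, weylOf (E J) (B J) a b c g * r J =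
      weylOf (fun i j => ∑ J ∈ s, E J i j * r J) (fun i j => ∑ J ∈ s, B J i j * r J) a b c g := by
  simp only [weylOf, Finset.sum_mul]
  rw [Finset.sum_comm]
  refine Finset.sum_congr rfl fun i _ => ?_
  rw [Finset.sum_comm]
  refine Finset.sum_congr rfl fun j _ => ?_
  rw [Finset.mul_sum, Finset.mul_sum, ← Finset.sum_add_distrib]
  exact Finset.sum_congr rfl fun J _ => by ring

theorem linearPart_mulVec (v : UpsIdx → ℝ) : linearPart *ᵥ v =
    Sum.elim (fun p => -(kd 0 p.2 * v (.inr (.inl (.inr (.inr p.1))))))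
      (Sum.elim
        (Sum.elim (fun p => v (.inr (.inr (p.1, p.2.succ))))
          (Sum.elim 0 fun i => v (.inr (.inr (i, 0)))))
        0) := by
  ext I
  rcases I with ⟨i, ν⟩ | (⟨i, j⟩ | ⟨i, j⟩ | i) | ⟨i, a⟩ <;>
    simp [Matrix.mulVec, dotProduct, Fintype.sum_sum_type, Fintype.sum_prod_type, linearPart, kd]

theorem quadraticPart_mulVec (Γ : ConnIdx → ℝ) (v : UpsIdx → ℝ) : quadraticPart Γ *ᵥ v =
    Sum.elim (fun p => -∑ j, Γ (.inl (p.1, j)) * v (.inl (j, p.2)))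
      (Sum.elim
        (Sum.elim (fun p => -∑ j, Γ (.inl (p.1, j)) * v (.inr (.inl (.inl (j, p.2)))))
          (Sum.elim (fun p => -∑ j, Γ (.inl (p.1, j)) * v (.inr (.inl (.inr (.inl (j, p.2))))))
            fun i => -∑ j, Γ (.inl (i, j)) * v (.inr (.inl (.inr (.inr j))))))
        fun p => -∑ j, Γ (.inl (p.1, j)) * v (.inr (.inr (j, p.2)))) := by
  ext I
  rcases I with ⟨i, ν⟩ | (⟨i, j⟩ | ⟨i, j⟩ | i) | ⟨i, a⟩ <;>
    simp [Matrix.mulVec, dotProduct, Fintype.sum_sum_type, Fintype.sum_prod_type, quadraticPart, kd]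

namespace Fields

variable {u : Fields} {U : Set Coord} {x : Coord} {Ξ : Coord → ℝ} {κ : Fin 4 → Coord → ℝ}

theorem IsConfiguration.sum_elBasis_mul_phi (hc : u.IsConfiguration U) (hx : x ∈ U)
    (i j : Fin 3) : ∑ J, elBasis J i j * u.phi x J = u.el i j x := by
  refine Eq.trans ?_ (congr_fun₂ (ofStf_stf (hc.isSTF_el hx)) i j)
  simp [Fintype.sum_sum_type, elBasis, phi, ofStf, mul_comm]

theorem IsConfiguration.sum_magBasis_mul_phi (hc : u.IsConfiguration U) (hx : x ∈ U)
    (i j : Fin 3) : ∑ J, magBasis J i j * u.phi x J = u.mag i j x := by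
  refine Eq.trans ?_ (congr_fun₂ (ofStf_stf (hc.isSTF_mag hx)) i j)
  simp [Fintype.sum_sum_type, magBasis, phi, ofStf, mul_comm]

theorem IsConfiguration.sourcePart_mulVec (hc : u.IsConfiguration U) (hx : x ∈ U) :
    sourcePart Ξ κ x *ᵥ u.phi x =
    Sum.elim (fun _ => 0)
      (Sum.elim
        (Sum.elim (fun p => -(Ξ x * u.el p.2 p.1 x))
          (Sum.elim (fun p => -(Ξ x * u.mag p.2 p.1 x)) fun _ => 0))
        fun p => ∑ c, κ c x * u.d c p.2 0 p.1.succ x) := by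
  ext I
  rcases I with ⟨i, ν⟩ | (⟨i, j⟩ | ⟨i, j⟩ | i) | ⟨i, a⟩
  · simp [Matrix.mulVec, dotProduct, sourcePart]
  · simp only [Matrix.mulVec, dotProduct, sourcePart, neg_mul, mul_assoc, Finset.sum_neg_distrib,
      ← Finset.mul_sum, hc.sum_elBasis_mul_phi hx, Sum.elim_inl, Sum.elim_inr]
  · simp only [Matrix.mulVec, dotProduct, sourcePart, neg_mul, mul_assoc, Finset.sum_neg_distrib,
      ← Finset.mul_sum, hc.sum_magBasis_mul_phi hx, Sum.elim_inl, Sum.elim_inr]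
  · simp [Matrix.mulVec, dotProduct, sourcePart]
  · simp only [Matrix.mulVec, dotProduct, sourcePart, Sum.elim_inr, Finset.sum_mul]
    rw [Finset.sum_comm]
    simp only [mul_assoc, ← Finset.mul_sum, sum_weylOf_mul, hc.sum_elBasis_mul_phi hx,
      hc.sum_magBasis_mul_phi hx, hc.d_eq hx]

/-- The rows of the first equation of the hyperbolic system, written out. -/
theorem ode_iff (hc : u.IsConfiguration U) (hx : x ∈ U) :
    ((fun I => pd 0 (fun y => u.upsilon y I) x) = linearPart *ᵥ u.upsilon x
      + quadraticPart (u.connVec x) *ᵥ u.upsilon x + sourcePart Ξ κ x *ᵥ u.phi x) ↔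
    (∀ (i : Fin 3) (ν : Fin 4), pd 0 (u.e i.succ ν) x =
      -(kd 0 ν * u.f i.succ x) - ∑ j : Fin 3, u.Γ i.succ j.succ 0 x * u.e j.succ ν x) ∧
    (∀ i j : Fin 3, pd 0 (u.Γ i.succ j.succ 0) x = u.L i.succ j.succ x
      - ∑ k : Fin 3, u.Γ i.succ k.succ 0 x * u.Γ k.succ j.succ 0 x - Ξ x * u.el j i x) ∧
    (∀ i k : Fin 3, pd 0 (u.Γ i.succ (k + 1).succ (k + 2).succ) x =
      -∑ j : Fin 3, u.Γ i.succ j.succ 0 x * u.Γ j.succ (k + 1).succ (k + 2).succ x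
        - Ξ x * u.mag k i x) ∧
    (∀ i : Fin 3, pd 0 (u.f i.succ) x =
      u.L i.succ 0 x - ∑ j : Fin 3, u.Γ i.succ j.succ 0 x * u.f j.succ x) ∧
    (∀ (i : Fin 3) (a : Fin 4), pd 0 (u.L i.succ a) x =
      -∑ j : Fin 3, u.Γ i.succ j.succ 0 x * u.L j.succ a x + ∑ c, κ c x * u.d c a 0 i.succ x) := by
  rw [linearPart_mulVec, quadraticPart_mulVec, hc.sourcePart_mulVec hx, funext_iff]
  simp only [Sum.forall, Prod.forall, Pi.add_apply, Sum.elim_inl, Sum.elim_inr, upsilon, frameVec,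
    connVec, schoutenVec, Pi.zero_apply, zero_add, add_zero, sub_eq_add_neg, and_assoc]

/-! ### Recovering the dependent components -/

/-- The right-hand side of the evolution equation of `Γ̂_b{}^c{}_d`. -/
def connRate (u : Fields) (Ξ : Coord → ℝ) (b c d : Fin 4) (x : Coord) : ℝ :=
  -∑ g, u.Γ g c d x * u.Γ b g 0 x + Ξ x * u.d c d 0 b x
    + kd d c * u.L b 0 x + kd 0 c * u.L b d x - eta d 0 * ∑ g, eta c g * u.L b g x

theorem sum_Γ_mul (hg : u.ConformalGaussianGauge U) (hx : x ∈ U) (c d b : Fin 4) :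
    ∑ g, u.Γ g c d x * u.Γ b g 0 x =
      ∑ k : Fin 3, u.Γ b k.succ 0 x * u.Γ k.succ c d x := by
  rw [Fin.sum_univ_succ, hg.weyl_propagated x hx, zero_mul, zero_add]
  exact Finset.sum_congr rfl fun k _ => mul_comm _ _

theorem connRate_zero (hc : u.IsConfiguration U) (hg : u.ConformalGaussianGauge U) (hx : x ∈ U)
    (c d : Fin 4) : u.connRate Ξ 0 c d x = 0 := by
  simp [connRate, hg.weyl_propagated x hx, hg.schouten_zero x hx, hc.d_self_right hx]

theorem connRate_zero_zero (hc : u.IsConfiguration U) (hg : u.ConformalGaussianGauge U)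
    (hx : x ∈ U) (i : Fin 3) : u.connRate Ξ i.succ 0 0 x =
      u.L i.succ 0 x - ∑ j : Fin 3, u.Γ i.succ j.succ 0 x * u.f j.succ x := by
  rw [connRate, sum_Γ_mul hg hx, hc.d_self_left hx, sum_eta_mul]
  simp only [hc.Γ_zero_zero hx]
  simp [kd, eta]
  ring

theorem connRate_succ_zero (hc : u.IsConfiguration U) (hg : u.ConformalGaussianGauge U)
    (hx : x ∈ U) (i j : Fin 3) : u.connRate Ξ i.succ j.succ 0 x = u.L i.succ j.succ x
      - ∑ k : Fin 3, u.Γ i.succ k.succ 0 x * u.Γ k.succ j.succ 0 x - Ξ x * u.el j i x := by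
  rw [connRate, sum_Γ_mul hg hx, hc.d_eq hx, weylOf_succ_zero_zero_succ, sum_eta_mul]
  simp [kd, eta, Fin.succ_ne_zero, (Fin.succ_ne_zero _).symm]
  ring

theorem connRate_zero_succ (hc : u.IsConfiguration U) (hg : u.ConformalGaussianGauge U)
    (hx : x ∈ U) (i j : Fin 3) :
    u.connRate Ξ i.succ 0 j.succ x = u.connRate Ξ i.succ j.succ 0 x := by
  rw [connRate_succ_zero hc hg hx, connRate, sum_Γ_mul hg hx, hc.d_eq hx,
    weylOf_zero_succ_zero_succ]
  simp only [hc.Γ_zero_succ hx]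
  simp [kd, eta, Fin.succ_ne_zero]
  ring

theorem connRate_succ_succ (hc : u.IsConfiguration U) (hg : u.ConformalGaussianGauge U)
    (hx : x ∈ U) (i j k : Fin 3) : u.connRate Ξ i.succ j.succ k.succ x =
      -∑ l : Fin 3, u.Γ i.succ l.succ 0 x * u.Γ l.succ j.succ k.succ x
        - Ξ x * ∑ m, eps3 j k m * u.mag m i x + kd j k * u.L i.succ 0 x := by
  rw [connRate, sum_Γ_mul hg hx, hc.d_eq hx, weylOf_succ_succ_zero_succ]
  simp only [eta_succ_succ, kd_succ_succ, kd_comm k j]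
  simp [kd, eta, Fin.succ_ne_zero, (Fin.succ_ne_zero _).symm]
  ring

theorem IsConfiguration.pd_Γ_succ_succ (hc : u.IsConfiguration U) (hU : IsOpen U) (hx : x ∈ U)
    (μ a : Fin 4) (j k : Fin 3) : pd μ (u.Γ a j.succ k.succ) x =
      ∑ n : Fin 3, eps3 j k n * pd μ (u.Γ a (n + 1).succ (n + 2).succ) x
        + kd j k * pd μ (u.f a) x := by
  have hΓ := differentiableAt_Γ hc hU hx a
  have hf : DifferentiableAt ℝ (u.f a) x :=
    (DifferentiableAt.fun_sum fun b _ => hΓ b b).const_mul _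
  rw [pd_congr_of_isOpen hU (fun y hy => hc.Γ_succ_succ_eq_sum hy a j k) hx,
    pd_add (DifferentiableAt.fun_sum fun n _ => (hΓ _ _).const_mul _) (hf.const_mul _),
    pd_const_mul hf, pd_sum fun n _ => (hΓ _ _).const_mul _]
  congr 1
  exact Finset.sum_congr rfl fun n _ => pd_const_mul (hΓ _ _) _ _

/-- The evolution equations for `υ` hold if and only if they hold for the independent components:
the gauge fixes the components along `e_0`, and the metric condition and the symmetries of the
Weyl tensor give the rest. -/
theorem transport_iff (hc : u.IsConfiguration U) (hg : u.ConformalGaussianGauge U) (hU : IsOpen U)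
    (hx : x ∈ U) :
    ((∀ b ν, pd 0 (u.e b ν) x = -∑ c, u.Γ b c 0 x * u.e c ν x) ∧
      (∀ b c d, pd 0 (u.Γ b c d) x = u.connRate Ξ b c d x) ∧
      (∀ i : Fin 3, pd 0 (u.f i.succ) x =
        -∑ j : Fin 3, u.f j.succ x * u.Γ i.succ j.succ 0 x + u.L i.succ 0 x) ∧
      (∀ d b, pd 0 (u.L d b) x =
        -∑ c, u.Γ d c 0 x * u.L c b x + ∑ a, κ a x * u.d a b 0 d x)) ↔
    (∀ (i : Fin 3) (ν : Fin 4), pd 0 (u.e i.succ ν) x =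
      -(kd 0 ν * u.f i.succ x) - ∑ j : Fin 3, u.Γ i.succ j.succ 0 x * u.e j.succ ν x) ∧
    (∀ i j : Fin 3, pd 0 (u.Γ i.succ j.succ 0) x = u.L i.succ j.succ x
      - ∑ k : Fin 3, u.Γ i.succ k.succ 0 x * u.Γ k.succ j.succ 0 x - Ξ x * u.el j i x) ∧
    (∀ i k : Fin 3, pd 0 (u.Γ i.succ (k + 1).succ (k + 2).succ) x =
      -∑ j : Fin 3, u.Γ i.succ j.succ 0 x * u.Γ j.succ (k + 1).succ (k + 2).succ x
        - Ξ x * u.mag k i x) ∧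
    (∀ i : Fin 3, pd 0 (u.f i.succ) x =
      u.L i.succ 0 x - ∑ j : Fin 3, u.Γ i.succ j.succ 0 x * u.f j.succ x) ∧
    (∀ (i : Fin 3) (a : Fin 4), pd 0 (u.L i.succ a) x =
      -∑ j : Fin 3, u.Γ i.succ j.succ 0 x * u.L j.succ a x
        + ∑ c, κ c x * u.d c a 0 i.succ x) := by
  have hframe : ∀ (i : Fin 3) (ν : Fin 4), -∑ c, u.Γ i.succ c 0 x * u.e c ν x =
      -(kd 0 ν * u.f i.succ x) - ∑ j : Fin 3, u.Γ i.succ j.succ 0 x * u.e j.succ ν x :=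
    fun i ν => by
      rw [Fin.sum_univ_succ, hc.Γ_zero_zero hx, hg.time_leg x hx]; ring
  have hschouten : ∀ (i : Fin 3) (a : Fin 4), ∑ c, u.Γ i.succ c 0 x * u.L c a x =
      ∑ j : Fin 3, u.Γ i.succ j.succ 0 x * u.L j.succ a x := fun i a => by
    rw [Fin.sum_univ_succ, hg.schouten_zero x hx, mul_zero, zero_add]
  have hcov : ∀ i : Fin 3, -∑ j : Fin 3, u.f j.succ x * u.Γ i.succ j.succ 0 x + u.L i.succ 0 x =
      u.L i.succ 0 x - ∑ j : Fin 3, u.Γ i.succ j.succ 0 x * u.f j.succ x := fun i => by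
    simp only [mul_comm (u.f _ x)]; ring
  constructor
  · rintro ⟨h1, h2, h3, h4⟩
    refine ⟨fun i ν => ?_, fun i j => ?_, fun i k => ?_, fun i => ?_, fun i a => ?_⟩
    · rw [h1, hframe]
    · rw [h2, connRate_succ_zero hc hg hx]
    · rw [h2, connRate_succ_succ hc hg hx, sum_eps3_cyclic k fun m => u.mag m i x, kd_cyclic]
      ring
    · rw [h3, hcov]
    · rw [h4, hschouten]
  · rintro ⟨h1, h2, h3, h4, h5⟩
    refine ⟨fun b ν => ?_, fun b c d => ?_, fun i => ?_, fun d b => ?_⟩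
    · induction b using Fin.cases with
      | zero =>
        rw [pd_eq_zero_of_const hU (fun y hy => hg.time_leg y hy ν) hx]
        simp [hg.weyl_propagated x hx]
      | succ i => rw [h1, hframe]
    · induction b using Fin.cases with
      | zero =>
        rw [pd_eq_zero_of_const hU (fun y hy => hg.weyl_propagated y hy d c) hx,
          connRate_zero hc hg hx]
      | succ i =>
        induction c using Fin.cases with
        | zero =>
          induction d using Fin.cases with
          | zero =>
            rw [pd_congr_of_isOpen hU (fun y hy => hc.Γ_zero_zero hy i.succ) hx,
              connRate_zero_zero hc hg hx]
            exact h4 i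
          | succ k =>
            rw [pd_congr_of_isOpen hU (fun y hy => hc.Γ_zero_succ hy i.succ k) hx,
              connRate_zero_succ hc hg hx, connRate_succ_zero hc hg hx]
            exact h2 i k
        | succ j =>
          induction d using Fin.cases with
          | zero => rw [h2, connRate_succ_zero hc hg hx]
          | succ k =>
            rw [hc.pd_Γ_succ_succ hU hx, connRate_succ_succ hc hg hx]
            simp only [h3, h4, hc.Γ_succ_succ_eq_sum hx _ j k, mul_sub, mul_add, mul_neg,
              Finset.sum_sub_distrib, Finset.sum_neg_distrib, Finset.sum_add_distrib,
              Finset.mul_sum]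
            rw [Finset.sum_comm]
            simp only [mul_left_comm]
            ring
    · rw [hcov, h4]
    · induction d using Fin.cases with
      | zero =>
        rw [pd_eq_zero_of_const hU (fun y hy => hg.schouten_zero y hy b) hx]
        simp [hg.weyl_propagated x hx, hc.d_self_right hx]
      | succ i => rw [h5, hschouten]

theorem evolutionEquations_iff (hc : u.IsConfiguration U) (hg : u.ConformalGaussianGauge U)
    (hU : IsOpen U) : u.EvolutionEquations Ξ κ U ↔
      u.HyperbolicSystem linearPart quadraticPart (sourcePart Ξ κ) principal lowerOrder U := by
  constructor
  · intro h
    exact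
      { ode := fun x hx => (ode_iff hc hx).2 <| (transport_iff hc hg hU hx).1
          ⟨h.frame x hx, h.connection x hx, h.covector x hx, h.schouten x hx⟩
        pde := fun x hx => (pde_iff hc hg hU hx).2 ⟨h.electric x hx, h.magnetic x hx⟩ }
  · intro h
    have h1 := fun x hx => (transport_iff hc hg hU hx).2 ((ode_iff hc hx).1 (h.ode x hx))
    have h2 := fun x hx => (pde_iff hc hg hU hx).1 (h.pde x hx)
    exact
      { frame := fun x hx => (h1 x hx).1
        connection := fun x hx => (h1 x hx).2.1
        covector := fun x hx => (h1 x hx).2.2.1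
        schouten := fun x hx => (h1 x hx).2.2.2
        electric := fun x hx => (h2 x hx).1
        magnetic := fun x hx => (h2 x hx).2 }

end Fields

end XCFE

end

theorem mainTheorem4 :
    ∃ (K : Matrix XCFE.UpsIdx XCFE.UpsIdx ℝ)
      (Q : (XCFE.ConnIdx → ℝ) → Matrix XCFE.UpsIdx XCFE.UpsIdx ℝ)
      (A : Fin 4 → (XCFE.FrameIdx → ℝ) → Matrix XCFE.PhiIdx XCFE.PhiIdx ℝ)
      (B : (XCFE.ConnIdx → ℝ) → Matrix XCFE.PhiIdx XCFE.PhiIdx ℝ),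
      (∀ I J, ContDiff ℝ ∞ (fun Γ => Q Γ I J)) ∧
      (∀ μ I J, ContDiff ℝ ∞ (fun e => A μ e I J)) ∧
      (∀ I J, ContDiff ℝ ∞ (fun Γ => B Γ I J)) ∧
      (∀ μ e, (A μ e).IsHermitian) ∧
      (∀ e : XCFE.FrameIdx → ℝ, ∑ i : Fin 3, e (i, 0) ^ 2 < 1 → (1 + A 0 e).PosDef) ∧
      ∀ (U : Set XCFE.Coord) (Ξ : XCFE.Coord → ℝ) (κ : Fin 4 → XCFE.Coord → ℝ),
        IsOpen U → ContDiffOn ℝ ∞ Ξ U → (∀ a, ContDiffOn ℝ ∞ (κ a) U) →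
        ∃ Lm : XCFE.Coord → Matrix XCFE.UpsIdx XCFE.PhiIdx ℝ,
          (∀ I J, ContDiffOn ℝ ∞ (fun x => Lm x I J) U) ∧
          ∀ u : XCFE.Fields, u.IsConfiguration U → u.ConformalGaussianGauge U →
            (u.ExtendedCFE Ξ κ U → u.EvolutionEquations Ξ κ U) ∧
            (u.EvolutionEquations Ξ κ U ↔ u.HyperbolicSystem K Q Lm A B U) :=
  ⟨XCFE.linearPart, XCFE.quadraticPart, XCFE.principal, XCFE.lowerOrder,
    XCFE.contDiff_quadraticPart, XCFE.contDiff_principal, XCFE.contDiff_lowerOrder,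
    XCFE.isHermitian_principal, XCFE.posDef_one_add_principal, fun _ Ξ κ hU hΞ hκ =>
      ⟨XCFE.sourcePart Ξ κ, XCFE.contDiffOn_sourcePart hΞ hκ, fun _ hc hg =>
        ⟨XCFE.Fields.evolutionEquations_of_extendedCFE hc hg hU,
          XCFE.Fields.evolutionEquations_iff hc hg hU⟩⟩⟩
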